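/- Let $F=\mathbb{Q}(\alpha)$ and let $\Lambda_F=F[p_1,p_2,\dots]$ be the ring of symmetric functions over $F$ ($p_k$ the power sums), with the scalar product $\langle p_\lambda,p_\mu\rangle=\delta_{\lambda\mu}\alpha^{l(\lambda)}z_\lambda$, where $z_\lambda=\prod_{i\ge1}i^{m_i}m_i!$ and $m_i=m_i(\lambda)$ is the multiplicity of $i$ in $\lambda$. Write $\le$ for the dominance order on partitions of $n$. Let $P_\lambda(\alpha)$ be the Jack symmetric functions, defined by $P_\lambda=\sum_{\mu\le\lambda}c_{\lambda\mu}m_\mu$ with $c_{\lambda\mu}\in F$, $c_{\lambda\lambda}=1$ ($m_\mu$ the monomial symmetric functions) and $\langle P_\lambda,P_\mu\rangle=0$ for $\lambda\ne\mu$, and let $Q_\lambda(\alpha)=\langle P_\lambda,P_\lambda\rangle^{-1}P_\lambda(\alpha)$. Put $Q_k=\sum_{\nu\vdash k}\alpha^{-l(\nu)}z_\nu^{-1}p_\nu$ and $q_\lambda=Q_{\lambda_1}Q_{\lambda_2}\cdots$. Let $$D(\alpha)=\sum_{i,j\ge1}(i+j)\alpha\,p_ip_j\frac{\partial}{\partial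 p_{i+j}}+\sum_{i,j\ge1}ij\alpha^2p_{i+j}\frac{\partial^2}{\partial p_i\partial p_j}+\alpha(\alpha-1)\sum_{k\ge1}k^2p_k\frac{\partial}{\partial p_k},$$ $$D'(\alpha)=\frac1{2\alpha}\Big(D(\alpha)-\sum_{k\ge1}k\alpha\,p_k\frac{\partial}{\partial p_k}\Big),\qquad e'_\lambda(\alpha)=\frac{\alpha}{2}\sum_i\lambda_i^2-\sum_i i\lambda_i .$$ For partitions $\lambda,\mu$ of $n$ set $r_{\lambda\lambda}=e'_\lambda(\alpha)$; if $\mu$ is obtained from $\lambda$ by moving $k$ squares from row $j$ to row $i$, where $i<j$ and $0<k\le\lambda_j$, and then rearranging the rows in decreasing order, set $$r_{\lambda\mu}=(1+\delta_{\lambda_i\lambda_j})^{-1}m_{\lambda_i}(\lambda)\big(m_{\lambda_j}(\lambda)-\delta_{\lambda_i\lambda_j}\big)(\lambda_i-\lambda_j+2k)$$ (this does not depend on the choice of $i,j,k$); set $r_{\lambda\mu}=0$ otherwise. Theorem 5.4. Let $\lambda$ be a partition of $n$, and let $\mu^1<^L\mu^2<^L\cdots<^L\mu^s$ be all the partitions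 $\mu$ of $n$ with $\mu\ge\lambda$ in the dominance order, arranged in lexicographic order ($\mu<^L\nu$ if the first nonzero difference $\nu_i-\mu_i$ is positive). Let $M_\lambda=(r_{\mu^j\mu^i})_{1\le i,j\le s}$. Then $\mu^1=\lambda$, and $M_\lambda$ is the matrix of $D'(\alpha)$, that is, $D'(\alpha)q_{\mu^j}=\sum_i r_{\mu^j\mu^i}q_{\mu^i}$ for all $j$. There is a unique vector $X_\lambda=(C_{\lambda\mu^1},\dots,C_{\lambda\mu^s})^t$ over $F$ with $Q_\lambda=\sum_iC_{\lambda\mu^i}q_{\mu^i}$, and it satisfies $$M_\lambda X_\lambda=e'_\lambda(\alpha)X_\lambda .$$ Moreover $$Q_\lambda(\alpha)=c_\lambda\det N_\lambda,\qquad c_\lambda=\prod_{i=2}^s\big(e'_{\mu^i}(\alpha)-e'_{\mu^1}(\alpha)\big)^{-1},$$ where $N_\lambda$ is the matrix $M_\lambda-e'_\lambda(\alpha)\,\mathrm{Id}$ with its first row replaced by $(q_{\mu^1},\dots,q_{\mu^s})$. -/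

import Mathlib

namespace JackDet

/-! ### The ring of symmetric functions over the field `ℚ(α)` -/

/-- The field `F = ℚ(α)` of rational functions in an indeterminate `α`. -/
abbrev F : Type := RatFunc ℚ

/-- The indeterminate `α`. -/
noncomputable abbrev al : F := RatFunc.X

/-- The ring `Λ_F` of symmetric functions over `F`, as the polynomial ring in the power sums
`p_1, p_2, …`; the variable `X k` is `p_k`. -/
abbrev SymF : Type := MvPolynomial ℕ+ F

/-- The power sum `p_k`, for `k ≥ 1` (only used for such `k`). -/
noncomputable def p (k : ℕ) : SymF := MvPolynomial.X k.toPNat'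

/-- The symmetric polynomial `f(x_1, …, x_N)` obtained from the symmetric function `f`: the
`F`-algebra homomorphism that sends `p_k` to `x_1 ^ k + ⋯ + x_N ^ k`. A symmetric function is
determined by these polynomials for all `N`. -/
noncomputable def toVars (N : ℕ) : SymF →ₐ[F] MvPolynomial (Fin N) F :=
  MvPolynomial.aeval fun k : ℕ+ => MvPolynomial.psum (Fin N) F (k : ℕ)

/-- The (Jack) scalar product on `Λ_F`: the `F`-bilinear form with
`⟨p_λ, p_μ⟩ = δ_{λμ} α ^ l(λ) z_λ`. An exponent `d` encodes the partition `λ` with `d k` parts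
equal to `k`, for which `p_λ` is the monomial of exponent `d`, `l(λ) = ∑ d k` and
`z_λ = ∏ k ^ (d k) (d k)!`. -/
noncomputable def scalar (f g : SymF) : F :=
  ∑ d ∈ f.support, f.coeff d * g.coeff d *
    (al ^ (d.sum fun _ m => m) * d.prod fun k m => ((k : ℕ) : F) ^ m * (m.factorial : F))

/-! ### Partitions -/

variable {n : ℕ}

/-- `part lam i` is the `(i+1)`-st largest part of `lam`, and `0` beyond the length. -/
def part (lam : n.Partition) (i : ℕ) : ℕ := (lam.parts.sort (· ≥ ·)).getD i 0

/-- Dominance order: `DomLE mu lam` means `mu ≤ lam`. -/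
def DomLE (mu lam : n.Partition) : Prop :=
  ∀ i : ℕ, ∑ j ∈ Finset.range i, part mu j ≤ ∑ j ∈ Finset.range i, part lam j

/-- `LexLT mu lam` means `mu <^L lam`: the first non-vanishing difference of the parts of `lam`
and `mu` is positive. -/
def LexLT (mu lam : n.Partition) : Prop :=
  ∃ i : ℕ, (∀ j < i, part mu j = part lam j) ∧ part mu i < part lam i

/-- `mu 0 <^L mu 1 <^L ⋯ <^L mu s` are all the partitions `≥ lam` (in the dominance order),
arranged in lexicographic order. -/
def IsLexEnum (lam : n.Partition) {s : ℕ} (mu : Fin (s + 1) → n.Partition) : Prop :=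
  (∀ i j : Fin (s + 1), i < j → LexLT (mu i) (mu j)) ∧
    ∀ nu : n.Partition, DomLE lam nu ↔ ∃ i, mu i = nu

/-- `z_λ = ∏_{i ≥ 1} i ^ {m_i} m_i!`. -/
def z (lam : n.Partition) : ℕ :=
  ∏ i ∈ lam.parts.toFinset, i ^ lam.parts.count i * (lam.parts.count i).factorial

/-! ### Jack symmetric functions -/

/-- `P` is the family of the Jack symmetric functions `P_λ` of degree `n`: it satisfies
`P_λ = ∑_{μ ≤ λ} c_{λμ} m_μ` with `c_{λλ} = 1`, where `m_μ` is the monomial symmetric function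
(the identity is expressed in every number `N` of variables), and `⟨P_λ, P_μ⟩ = 0` for `λ ≠ μ`. -/
def IsJackFamily (n : ℕ) (P : n.Partition → SymF) : Prop :=
  (∀ lam : n.Partition, ∃ c : n.Partition → F,
    c lam = 1 ∧ (∀ mu, ¬ DomLE mu lam → c mu = 0) ∧
      ∀ N : ℕ, toVars N (P lam) = ∑ mu, c mu • MvPolynomial.msymm (Fin N) F mu) ∧
  ∀ lam mu : n.Partition, lam ≠ mu → scalar (P lam) (P mu) = 0

/-- The dual Jack function `Q_λ = ⟨P_λ, P_λ⟩⁻¹ P_λ`. -/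
noncomputable def jackQ (P : n.Partition → SymF) (lam : n.Partition) : SymF :=
  (scalar (P lam) (P lam))⁻¹ • P lam

/-- `p_λ = p_{λ_1} p_{λ_2} ⋯`. -/
noncomputable def pPart (lam : n.Partition) : SymF := (lam.parts.map p).prod

/-- `Q_n = ∑_{λ ⊢ n} α ^ {-l(λ)} z_λ⁻¹ p_λ`. -/
noncomputable def qRow (n : ℕ) : SymF :=
  ∑ lam : n.Partition, ((al ^ lam.parts.card)⁻¹ * (z lam : F)⁻¹) • pPart lam

/-- The generalized homogeneous symmetric function `q_λ = Q_{λ_1} Q_{λ_2} ⋯`. -/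
noncomputable def q (lam : n.Partition) : SymF := (lam.parts.map qRow).prod

/-! ### The operators `D(α)` and `D'(α)` -/

/-- The operator
`D(α) = ∑_{i,j} (i+j) α p_i p_j ∂/∂p_{i+j} + ∑_{i,j} i j α² p_{i+j} ∂²/∂p_i∂p_j
  + α (α-1) ∑_k k² p_k ∂/∂p_k`;
on each `f` only finitely many terms of each sum are nonzero. -/
noncomputable def opD (f : SymF) : SymF :=
  (∑ᶠ ij : ℕ+ × ℕ+, (((ij.1 + ij.2 : ℕ+) : ℕ) * al : F) •
      (MvPolynomial.X ij.1 * MvPolynomial.X ij.2 * MvPolynomial.pderiv (ij.1 + ij.2) f)) +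
  (∑ᶠ ij : ℕ+ × ℕ+, ((ij.1 : ℕ) * (ij.2 : ℕ) * al ^ 2 : F) •
      (MvPolynomial.X (ij.1 + ij.2) *
        MvPolynomial.pderiv ij.1 (MvPolynomial.pderiv ij.2 f))) +
  (al * (al - 1)) • ∑ᶠ k : ℕ+, ((k : ℕ) ^ 2 : F) •
      (MvPolynomial.X k * MvPolynomial.pderiv k f)

/-- The operator `∑_k h_{-k} h_k = ∑_k k α p_k ∂/∂p_k`. -/
noncomputable def opE (f : SymF) : SymF :=
  ∑ᶠ k : ℕ+, ((k : ℕ) * al : F) • (MvPolynomial.X k * MvPolynomial.pderiv k f)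

/-- The operator `D'(α) = (2α)⁻¹ (D(α) - ∑_k h_{-k} h_k)`. -/
noncomputable def opD' (f : SymF) : SymF := (2 * al)⁻¹ • (opD f - opE f)

/-! ### The matrices -/

/-- `e'_λ(α) = (α / 2) ∑_i λ_i² - ∑_i i λ_i` (a partition of `n` has at most `n` parts; `part` is
indexed from `0`). -/
noncomputable def e' (lam : n.Partition) : F :=
  al / 2 * ∑ i ∈ Finset.range n, (part lam i : F) ^ 2 -
    ∑ i ∈ Finset.range n, ((i : F) + 1) * (part lam i : F)

/-- `mu` is `r_j^i(k).lam`, where `i < j` and `0 < k ≤ λ_j`: it is obtained from `lam` by moving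
`k` squares from row `j` to row `i` and rearranging the rows (with empty rows dropped). -/
def IsMoveUp (lam : n.Partition) (i j k : ℕ) (mu : n.Partition) : Prop :=
  i < j ∧ 0 < k ∧ k ≤ part lam j ∧
    mu.parts = (((lam.parts.erase (part lam i)).erase (part lam j)) +
      {part lam i + k, part lam j - k}).filter (· ≠ 0)

/-- The number
`(1 + δ_{λ_i λ_j})⁻¹ m_{λ_i}(λ) (m_{λ_j}(λ) - δ_{λ_i λ_j}) (λ_i - λ_j + 2k)`. -/
noncomputable def moveCoeff (lam : n.Partition) (i j k : ℕ) : F :=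
  let δ : F := if part lam i = part lam j then 1 else 0
  (1 + δ)⁻¹ * (lam.parts.count (part lam i) : F) * ((lam.parts.count (part lam j) : F) - δ) *
    ((part lam i : F) - (part lam j : F) + 2 * (k : F))

open Classical in
/-- The coefficient `r_{λμ}`: it is `e'_λ` if `μ = λ`, it is `moveCoeff λ i j k` if
`μ = r_j^i(k).λ` (the value does not depend on the choice of such `i, j, k`), and it is `0`
otherwise. -/
noncomputable def r (lam mu : n.Partition) : F :=
  if mu = lam then e' lam
  else if h : ∃ t : ℕ × ℕ × ℕ, IsMoveUp lam t.1 t.2.1 t.2.2 mu then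
    moveCoeff lam h.choose.1 h.choose.2.1 h.choose.2.2
  else 0

/-- The matrix `M_λ`, whose `(i, j)` entry is `r_{μ^j μ^i}`. -/
noncomputable def M {s : ℕ} (mu : Fin (s + 1) → n.Partition) :
    Matrix (Fin (s + 1)) (Fin (s + 1)) F :=
  Matrix.of fun i j => r (mu j) (mu i)

/-- The matrix `N_λ`: `M_λ - e'_λ Id` with its first row replaced by `(q_{μ^1}, …, q_{μ^s})`. -/
noncomputable def Nmat (lam : n.Partition) {s : ℕ} (mu : Fin (s + 1) → n.Partition) :
    Matrix (Fin (s + 1)) (Fin (s + 1)) SymF :=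
  ((M mu - e' lam • (1 : Matrix (Fin (s + 1)) (Fin (s + 1)) F)).map
    (MvPolynomial.C : F →+* SymF)).updateRow 0 fun i => q (mu i)

/-- The constant `c_λ`, the product over all `μ^i` but the first one of
`(e'_{μ^i} - e'_{μ^1})⁻¹`. -/
noncomputable def cConst {s : ℕ} (mu : Fin (s + 1) → n.Partition) : F :=
  ∏ i : Fin s, (e' (mu i.succ) - e' (mu 0))⁻¹

end JackDet

/-! The function $Q_\lambda$ is an eigenvector of a self-adjoint operator that is triangular on the
$q_\mu$; the determinant is Cramer's rule for its eigenvector equation.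

Multiplication by $p_k$ is adjoint to $k\alpha\,\partial/\partial p_k$ (`scalar_X_mul`). This
exchanges the first two sums of $D(\alpha)$ and fixes the remaining terms, so $D'$ is self-adjoint
(`scalar_opD'`). Moreover $k\alpha\,\partial Q_n/\partial p_k=Q_{n-k}$, and $D'$ has order two. Its
action on a product of $Q_n$'s is therefore determined by single factors (`opTrunc_qRow`) and pairs
of factors (`cross_qRow`). Each pair yields the raising moves together with a diagonal term;
counting the moves with the same result gives the coefficients $r_{\lambda\mu}$ (`opD'_q`). Raising
squares goes up in dominance order, so $D'$ is triangular with diagonal $e'_\lambda$.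

The scalar product with $q_\nu$ reads off a coefficient of monomials (`scalar_prod_qRow`), so the
$q_\nu$ are dual to the $m_\mu$. Triangularity of $P_\mu$ in the monomials then makes $Q_\lambda$
unitriangular in the $q_\mu$ with $\mu\ge\lambda$. Hence $\langle D'Q_\lambda,P_\nu\rangle=0$ unless
$\nu\ge\lambda$, and self-adjointness forces $\nu\le\lambda$ as well. Only $\nu=\lambda$ survives,
with value $e'_\lambda$ (`IsJackFamily.opD'_jackQ`).

Finally $N_\lambda X_\lambda=(Q_\lambda,0,\dots,0)^t$, and $X_\lambda$ has first entry $1$. Applying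
the adjugate gives $\det N_\lambda$ as $Q_\lambda$ times a triangular minor with diagonal
$e'_{\mu^i}-e'_\lambda$. These differences are nonzero because $\sum_i i\lambda_i$ is strictly
decreasing in dominance order. -/

namespace JackDet

/-! ### The scalar product as a bilinear form -/

/-- The number `α ^ l(λ) z_λ` of the partition encoded by an exponent. -/
noncomputable def expNorm (d : ℕ+ →₀ ℕ) : F :=
  al ^ (d.sum fun _ m => m) * d.prod fun k m => ((k : ℕ) : F) ^ m * (m.factorial : F)

/-- The size of the partition encoded by an exponent. -/
def expSize (d : ℕ+ →₀ ℕ) : ℕ := d.sum fun k m => (k : ℕ) * m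

theorem al_ne_zero : (al : F) ≠ 0 := RatFunc.X_ne_zero

theorem pnat_cast_ne_zero (k : ℕ+) : ((k : ℕ) : F) ≠ 0 := by
  exact_mod_cast k.pos.ne'

theorem expNorm_ne_zero (d : ℕ+ →₀ ℕ) : expNorm d ≠ 0 := by
  refine mul_ne_zero (pow_ne_zero _ al_ne_zero) (Finset.prod_ne_zero_iff.2 fun k _ => ?_)
  exact mul_ne_zero (pow_ne_zero _ (pnat_cast_ne_zero k)) (by exact_mod_cast Nat.factorial_ne_zero _)

theorem expNorm_zero : expNorm 0 = 1 := by simp [expNorm]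

theorem expSize_zero : expSize 0 = 0 := by simp [expSize]

theorem expSize_add (d e : ℕ+ →₀ ℕ) : expSize (d + e) = expSize d + expSize e :=
  Finsupp.sum_add_index' (by simp) (by intros; ring)

theorem expSize_single (k : ℕ+) (m : ℕ) : expSize (Finsupp.single k m) = k * m := by
  simp [expSize]

/-- The factor $d_k+1$ is the one produced by $\partial/\partial p_k$, so this ratio of norms is the
adjointness of $p_k$ and $k\alpha\,\partial/\partial p_k$ on monomials. -/
theorem expNorm_add_single (d : ℕ+ →₀ ℕ) (k : ℕ+) :
    expNorm (d + Finsupp.single k 1) = expNorm d * ((k : ℕ) * al * ((d k : F) + 1)) := by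
  have h1 : ((d + Finsupp.single k 1).sum fun _ m => m) = (d.sum fun _ m => m) + 1 := by
    rw [Finsupp.sum_add_index' (by simp) (by intros; rfl)]
    simp
  have h0 : ∀ i : ℕ+, ((i : ℕ) : F) ^ 0 * ((0 : ℕ).factorial : F) = 1 := by simp
  have he : (d + Finsupp.single k 1).erase k = d.erase k := by
    ext i
    by_cases h : i = k
    · simp [h]
    · simp [Finsupp.erase_ne h]
  have h2 := Finsupp.mul_prod_erase' d k (fun k m => ((k : ℕ) : F) ^ m * (m.factorial : F)) h0
  have h3 := Finsupp.mul_prod_erase' (d + Finsupp.single k 1) k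
    (fun k m => ((k : ℕ) : F) ^ m * (m.factorial : F)) h0
  rw [expNorm, expNorm, h1, ← h2, ← h3, he]
  simp only [Finsupp.add_apply, Finsupp.single_eq_same, Nat.factorial_succ]
  push_cast
  ring

/-- Freedom in the index set removes the asymmetry of the definition, which sums over the support of
the first argument. -/
theorem scalar_eq_sum (f g : SymF) (T : Finset (ℕ+ →₀ ℕ)) (h : f.support ∩ g.support ⊆ T) :
    scalar f g = ∑ d ∈ T, f.coeff d * g.coeff d * expNorm d := by
  have key : ∀ S : Finset (ℕ+ →₀ ℕ), f.support ∩ g.support ⊆ S →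
      ∑ d ∈ S, f.coeff d * g.coeff d * expNorm d =
        ∑ d ∈ f.support ∩ g.support, f.coeff d * g.coeff d * expNorm d := fun S hS => by
    refine (Finset.sum_subset hS fun d _ hd => ?_).symm
    simp only [Finset.mem_inter, MvPolynomial.mem_support_iff, not_and_or, not_not] at hd
    rcases hd with hd | hd <;> simp [hd]
  rw [key T h, ← key f.support Finset.inter_subset_left]
  rfl

theorem scalar_comm (f g : SymF) : scalar f g = scalar g f := by
  rw [scalar_eq_sum f g _ subset_rfl, scalar_eq_sum g f (f.support ∩ g.support)
    (by rw [Finset.inter_comm])]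
  exact Finset.sum_congr rfl fun d _ => by ring

theorem scalar_add_right (f g h : SymF) : scalar f (g + h) = scalar f g + scalar f h := by
  have hi (g : SymF) := scalar_eq_sum f g f.support Finset.inter_subset_left
  rw [hi, hi, hi, ← Finset.sum_add_distrib]
  exact Finset.sum_congr rfl fun d _ => by rw [MvPolynomial.coeff_add]; ring

theorem scalar_smul_right (a : F) (f g : SymF) : scalar f (a • g) = a * scalar f g := by
  have hi (g : SymF) := scalar_eq_sum f g f.support Finset.inter_subset_left
  rw [hi, hi, Finset.mul_sum]
  exact Finset.sum_congr rfl fun d _ => by rw [MvPolynomial.coeff_smul, smul_eq_mul]; ring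

/-- The scalar product as a bilinear map. -/
noncomputable def scalarBilin : SymF →ₗ[F] SymF →ₗ[F] F :=
  LinearMap.mk₂ F scalar
    (fun f g h => by rw [scalar_comm, scalar_add_right, scalar_comm h, scalar_comm h])
    (fun a f g => by rw [scalar_comm, scalar_smul_right, scalar_comm g]; rfl)
    scalar_add_right (fun a f g => scalar_smul_right a f g)

theorem scalarBilin_apply (f g : SymF) : scalarBilin f g = scalar f g := rfl

theorem scalar_monomial_left (d : ℕ+ →₀ ℕ) (a : F) (g : SymF) :
    scalar (MvPolynomial.monomial d a) g = a * g.coeff d * expNorm d := by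
  rw [scalar_eq_sum _ g {d} (Finset.inter_subset_left.trans MvPolynomial.support_monomial_subset)]
  simp

/-- The monomials in the $p_k$ are orthogonal with nonzero norms. -/
theorem eq_zero_of_scalar_eq_zero (f : SymF) (h : ∀ g, scalar g f = 0) : f = 0 := by
  ext d
  have := h (MvPolynomial.monomial d 1)
  rw [scalar_monomial_left, one_mul] at this
  simpa using (mul_eq_zero.1 this).resolve_right (expNorm_ne_zero d)

/-- Multiplication by `p_k` is adjoint to `k α ∂/∂p_k`. -/
theorem scalar_X_mul (k : ℕ+) (f g : SymF) :
    scalar (MvPolynomial.X k * f) g =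
      ((k : ℕ) * al : F) * scalar f (MvPolynomial.pderiv k g) := by
  induction f using MvPolynomial.induction_on' with
  | monomial d a =>
    have : (MvPolynomial.X k * MvPolynomial.monomial d a : SymF) =
        MvPolynomial.monomial (d + Finsupp.single k 1) a := by
      rw [MvPolynomial.X, MvPolynomial.monomial_mul, one_mul, add_comm]
    rw [this, scalar_monomial_left, scalar_monomial_left, MvPolynomial.coeff_pderiv,
      expNorm_add_single]
    ring
  | add f₁ f₂ h₁ h₂ =>
    rw [mul_add]
    simp only [← scalarBilin_apply, map_add, LinearMap.add_apply] at *
    rw [h₁, h₂]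
    ring

/-! ### The functions `Q_n` -/

/-- The exponent of `p_λ`. -/
noncomputable def partExp {n : ℕ} (lam : n.Partition) : ℕ+ →₀ ℕ :=
  Multiset.toFinsupp (lam.parts.map Nat.toPNat')

theorem map_coe_toPNat' (s : Multiset ℕ) (hs : ∀ i ∈ s, 0 < i) :
    (s.map Nat.toPNat').map (fun k : ℕ+ => (k : ℕ)) = s := by
  rw [Multiset.map_map]
  conv_rhs => rw [← Multiset.map_id s]
  refine Multiset.map_congr rfl fun i hi => ?_
  simp [Nat.toPNat'_coe, hs i hi]

theorem pPart_eq {n : ℕ} (lam : n.Partition) :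
    pPart lam = MvPolynomial.monomial (partExp lam) 1 := by
  unfold pPart partExp p
  induction lam.parts using Multiset.induction_on with
  | empty => simp
  | cons a s ih =>
    rw [Multiset.map_cons, Multiset.prod_cons, ih, Multiset.map_cons, ← Multiset.singleton_add,
      map_add, Multiset.toFinsupp_singleton, MvPolynomial.X, MvPolynomial.monomial_mul, one_mul]

theorem partExp_injective {n : ℕ} : Function.Injective (partExp (n := n)) := fun lam mu h => by
  have h1 := Multiset.toFinsupp.injective h
  apply Nat.Partition.ext
  rw [← map_coe_toPNat' lam.parts fun i hi => lam.parts_pos hi, h1,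
    map_coe_toPNat' mu.parts fun i hi => mu.parts_pos hi]

theorem expSize_eq_sum (s : Multiset ℕ+) :
    expSize (Multiset.toFinsupp s) = (s.map (fun k : ℕ+ => (k : ℕ))).sum := by
  induction s using Multiset.induction_on with
  | empty => simp [expSize_zero]
  | cons a s ih =>
    rw [← Multiset.singleton_add, map_add, expSize_add, ih, Multiset.toFinsupp_singleton,
      expSize_single]
    simp

theorem expSize_partExp {n : ℕ} (lam : n.Partition) : expSize (partExp lam) = n := by
  rw [partExp, expSize_eq_sum, map_coe_toPNat' _ fun i hi => lam.parts_pos hi, lam.parts_sum]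

theorem exists_partExp (d : ℕ+ →₀ ℕ) : ∃ lam : (expSize d).Partition, partExp lam = d := by
  refine ⟨⟨d.toMultiset.map (fun k : ℕ+ => (k : ℕ)), ?_, ?_⟩, ?_⟩
  · simp only [Multiset.mem_map]
    rintro _ ⟨k, -, rfl⟩
    exact k.pos
  · rw [← expSize_eq_sum, Finsupp.toMultiset_toFinsupp]
  · simp [partExp, Multiset.map_map]

theorem expNorm_partExp {n : ℕ} (lam : n.Partition) :
    expNorm (partExp lam) = al ^ lam.parts.card * (z lam : F) := by
  have hc : ∀ k : ℕ+, partExp lam k = lam.parts.count (k : ℕ) := fun k => by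
    conv_rhs => rw [← map_coe_toPNat' lam.parts fun i hi => lam.parts_pos hi]
    rw [Multiset.count_map_eq_count' _ _ PNat.coe_injective]
    exact Multiset.toFinsupp_apply _ _
  rw [expNorm]
  congr 1
  · congr 1
    have : (partExp lam).sum (fun _ m => m) = (Finsupp.toMultiset (partExp lam)).card := by
      rw [Finsupp.card_toMultiset]; rfl
    rw [this, partExp, Multiset.toFinsupp_toMultiset, Multiset.card_map]
  · rw [z, Finsupp.prod]
    push_cast
    refine Finset.prod_nbij' (fun k : ℕ+ => (k : ℕ)) Nat.toPNat' ?_ ?_ ?_ ?_ ?_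
    · intro k hk
      rw [Finsupp.mem_support_iff, hc] at hk
      exact Multiset.mem_toFinset.2 (Multiset.count_ne_zero.1 hk)
    · intro i hi
      have hi := Multiset.mem_toFinset.1 hi
      rw [Finsupp.mem_support_iff, hc, Nat.toPNat'_coe, if_pos (lam.parts_pos hi)]
      exact Multiset.count_ne_zero.2 hi
    · intro k _
      simp
    · intro i hi
      simp [Nat.toPNat'_coe, lam.parts_pos (Multiset.mem_toFinset.1 hi)]
    · intro k _
      rw [hc]

theorem coeff_qRow (n : ℕ) (d : ℕ+ →₀ ℕ) :
    (qRow n).coeff d = if expSize d = n then (expNorm d)⁻¹ else 0 := by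
  rw [qRow, MvPolynomial.coeff_sum]
  simp only [MvPolynomial.coeff_smul, pPart_eq, MvPolynomial.coeff_monomial]
  split_ifs with h
  · subst h
    obtain ⟨lam, hl⟩ := exists_partExp d
    rw [Finset.sum_eq_single lam]
    · have := expNorm_partExp lam
      rw [hl] at this
      rw [if_pos hl, this, mul_inv, smul_eq_mul, mul_one]
    · intro mu _ hmu
      rw [if_neg, smul_zero]
      exact fun h => hmu (partExp_injective (h.trans hl.symm))
    · simp
  · refine Finset.sum_eq_zero fun lam _ => ?_
    rw [if_neg, smul_zero]
    rintro rfl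
    exact h (expSize_partExp lam)

theorem expSize_eq_zero {d : ℕ+ →₀ ℕ} (h : expSize d = 0) : d = 0 := by
  ext k
  by_contra hk
  have : (k : ℕ) * d k = 0 := (Finset.sum_eq_zero_iff (s := d.support)).1 h k (by simpa using hk)
  simp at this
  exact hk this

theorem qRow_zero : qRow 0 = 1 := by
  ext d
  rw [coeff_qRow, MvPolynomial.coeff_one]
  by_cases h : d = 0
  · simp [h, expSize_zero, expNorm_zero]
  · rw [if_neg fun h' => h (expSize_eq_zero h'), if_neg (Ne.symm h)]

/-- The coefficients of $Q_n$ are inverse norms, so the norm ratio cancels the factor from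
differentiation. Equivalently, $\sum_n Q_nt^n=\exp\sum_k p_kt^k/(k\alpha)$. -/
theorem smul_pderiv_qRow (k : ℕ+) (n : ℕ) :
    ((k : ℕ) * al : F) • MvPolynomial.pderiv k (qRow n) =
      if (k : ℕ) ≤ n then qRow (n - k) else 0 := by
  have hk := pnat_cast_ne_zero k
  have hkp := k.pos
  ext d
  have hd : (d k : F) + 1 ≠ 0 := by exact_mod_cast Nat.succ_ne_zero (d k)
  rw [MvPolynomial.coeff_smul, MvPolynomial.coeff_pderiv, coeff_qRow, expSize_add, expSize_single,
    expNorm_add_single, smul_eq_mul, mul_one]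
  have e : ((k : ℕ) * al : F) * ((expNorm d * ((k : ℕ) * al * ((d k : F) + 1)))⁻¹ *
      ((d k : F) + 1)) = (expNorm d)⁻¹ := by
    field_simp [expNorm_ne_zero d, al_ne_zero]
  split_ifs with h1 h2 h2
  · rw [coeff_qRow, if_pos (by omega), e]
  · omega
  · rw [coeff_qRow, if_neg (by omega)]; simp
  · simp

theorem coeff_X_mul_pderiv (k : ℕ+) (f : SymF) (d : ℕ+ →₀ ℕ) :
    (MvPolynomial.X k * MvPolynomial.pderiv k f).coeff d = (d k : F) * f.coeff d := by
  rw [MvPolynomial.coeff_X_mul']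
  split_ifs with h
  · have hk : 1 ≤ d k := Nat.one_le_iff_ne_zero.2 (Finsupp.mem_support_iff.1 h)
    rw [MvPolynomial.coeff_pderiv, tsub_add_cancel_of_le (Finsupp.single_le_iff.2 hk)]
    simp only [Finsupp.coe_tsub, Pi.sub_apply, Finsupp.single_eq_same]
    rw [Nat.cast_sub hk]
    push_cast
    ring
  · rw [Finsupp.notMem_support_iff.1 h]
    simp

theorem p_succ (i : ℕ) : p (i + 1) = MvPolynomial.X i.succPNat := rfl

theorem sum_mul_exp_range {n K : ℕ} (hK : n ≤ K) {d : ℕ+ →₀ ℕ} (hd : expSize d = n) :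
    ∑ i ∈ Finset.range K, (i + 1) * d i.succPNat = n := by
  rw [← hd, expSize, Finsupp.sum]
  symm
  refine Finset.sum_of_injOn (fun k : ℕ+ => (k : ℕ) - 1) ?_ ?_ ?_ ?_
  · intro a _ b _ hab
    have ha := a.pos
    have hb := b.pos
    apply PNat.coe_injective
    simp only at hab
    omega
  · intro a ha
    have h1 : (a : ℕ) * d a ≤ expSize d :=
      Finset.single_le_sum (f := fun k : ℕ+ => (k : ℕ) * d k) (fun _ _ => Nat.zero_le _) ha
    have h2 : 1 ≤ d a := Nat.one_le_iff_ne_zero.2 (Finsupp.mem_support_iff.1 ha)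
    have := a.pos
    simp only [Finset.coe_range, Set.mem_Iio]
    nlinarith [Nat.sub_add_cancel a.pos]
  · intro i _ hi
    have : d i.succPNat = 0 := by
      by_contra h
      exact hi ⟨i.succPNat, by simpa using h, by simp⟩
    simp [this]
  · intro a _
    have : ((a : ℕ) - 1).succPNat = a := by
      apply PNat.coe_injective
      simpa using Nat.sub_add_cancel a.pos
    simp only [this, Nat.sub_add_cancel a.pos]

/-- The Newton type recursion `n α Q_n = ∑_{k = 1}^n p_k Q_{n - k}`. -/
theorem smul_qRow (n : ℕ) :
    ((n : F) * al) • qRow n = ∑ i ∈ Finset.range n, p (i + 1) * qRow (n - (i + 1)) := by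
  -- The right side thus becomes $\alpha\sum_k k\,p_k\,\partial Q_n/\partial p_k$, an Euler operator
  -- applied to a function homogeneous of degree $n$.
  have h : ∀ i ∈ Finset.range n, p (i + 1) * qRow (n - (i + 1)) =
      (((i + 1 : ℕ) : F) * al) •
        (MvPolynomial.X i.succPNat * MvPolynomial.pderiv i.succPNat (qRow n)) := fun i hi => by
    have := smul_pderiv_qRow i.succPNat n
    rw [if_pos (by simpa using Finset.mem_range.1 hi)] at this
    rw [p_succ, ← mul_smul_comm]
    simp only [Nat.succPNat_coe, Nat.succ_eq_add_one] at this
    rw [this]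
  rw [Finset.sum_congr rfl h]
  ext d
  simp only [MvPolynomial.coeff_sum, MvPolynomial.coeff_smul, coeff_X_mul_pderiv, smul_eq_mul]
  rw [coeff_qRow]
  split_ifs with hd
  · have := congrArg (Nat.cast : ℕ → F) (sum_mul_exp_range le_rfl hd)
    rw [← this]
    push_cast
    simp only [Finset.sum_mul]
    exact Finset.sum_congr rfl fun i _ => by ring
  · simp

open Filter

/-! ### The operator `D'(α)` -/

/-- The adjoint `(i + 1) α ∂/∂p_{i + 1}` of the multiplication by `p_{i + 1}`. -/
noncomputable def lower (i : ℕ) : Derivation F SymF SymF :=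
  (((i + 1 : ℕ) : F) * al) • MvPolynomial.pderiv i.succPNat

theorem lower_apply (i : ℕ) (f : SymF) :
    lower i f = (((i + 1 : ℕ) : F) * al) • MvPolynomial.pderiv i.succPNat f := rfl

theorem lower_qRow (i n : ℕ) :
    lower i (qRow n) = if i + 1 ≤ n then qRow (n - (i + 1)) else 0 := by
  simpa [lower_apply] using smul_pderiv_qRow i.succPNat n

theorem scalar_p_mul (i : ℕ) (f g : SymF) :
    scalar (p (i + 1) * f) g = scalar f (lower i g) := by
  rw [p_succ, scalar_X_mul, lower_apply, scalar_smul_right]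
  rfl

theorem scalar_lower_left (i : ℕ) (f g : SymF) :
    scalar (lower i f) g = scalar f (p (i + 1) * g) := by
  rw [scalar_comm, ← scalar_p_mul, scalar_comm]

/-- Adjoint to the commutativity of multiplication by power sums. -/
theorem lower_comm (i j : ℕ) (f : SymF) : lower i (lower j f) = lower j (lower i f) := by
  refine sub_eq_zero.1 (eq_zero_of_scalar_eq_zero _ fun g => ?_)
  rw [← scalarBilin_apply, map_sub]
  simp only [scalarBilin_apply, ← scalar_p_mul]
  rw [mul_left_comm, sub_self]

/-- The operator `D'(α)` with the summation indices bounded by `K`. -/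
noncomputable def opTrunc (K : ℕ) : SymF →ₗ[F] SymF :=
  (2 * al : F)⁻¹ • (∑ i ∈ Finset.range K, ∑ j ∈ Finset.range K,
      (LinearMap.mulLeft F (p (i + 1) * p (j + 1)) ∘ₗ (lower (i + j + 1)).toLinearMap +
        LinearMap.mulLeft F (p (i + j + 2)) ∘ₗ (lower i).toLinearMap ∘ₗ (lower j).toLinearMap) +
    ∑ i ∈ Finset.range K, ((al - 1) * ((i + 1 : ℕ) : F) - 1) •
      (LinearMap.mulLeft F (p (i + 1)) ∘ₗ (lower i).toLinearMap))

theorem opTrunc_apply (K : ℕ) (f : SymF) :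
    opTrunc K f = (2 * al : F)⁻¹ • (∑ i ∈ Finset.range K, ∑ j ∈ Finset.range K,
      (p (i + 1) * p (j + 1) * lower (i + j + 1) f + p (i + j + 2) * lower i (lower j f)) +
    ∑ i ∈ Finset.range K, ((al - 1) * ((i + 1 : ℕ) : F) - 1) • (p (i + 1) * lower i f)) := by
  simp [opTrunc, LinearMap.sum_apply, mul_assoc]

theorem eventually_pderiv_eq_zero (f : SymF) :
    ∃ K₀ : ℕ, ∀ k : ℕ+, K₀ < k → MvPolynomial.pderiv k f = 0 := by
  refine ⟨f.vars.sup fun k : ℕ+ => (k : ℕ), fun k hk => ?_⟩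
  refine MvPolynomial.pderiv_eq_zero_of_notMem_vars fun h => ?_
  exact absurd (Finset.le_sup (f := fun k : ℕ+ => (k : ℕ)) h) (not_le.2 hk)

theorem finsum_pnat_eq (g : ℕ+ → SymF) (K : ℕ) (h : ∀ k : ℕ+, K < k → g k = 0) :
    ∑ᶠ k, g k = ∑ i ∈ Finset.range K, g i.succPNat := by
  rw [← finsum_comp_equiv Equiv.pnatEquivNat.symm]
  refine finsum_eq_sum_of_support_subset _ fun i hi => ?_
  by_contra hK
  refine hi (h _ ?_)
  simpa [Nat.lt_succ_iff] using hK

theorem finsum_pnat_prod_eq (g : ℕ+ × ℕ+ → SymF) (K : ℕ)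
    (h : ∀ k l : ℕ+, K < k ∨ K < l → g (k, l) = 0) :
    ∑ᶠ kl, g kl = ∑ i ∈ Finset.range K, ∑ j ∈ Finset.range K, g (i.succPNat, j.succPNat) := by
  rw [← finsum_comp_equiv (Equiv.prodCongr Equiv.pnatEquivNat.symm Equiv.pnatEquivNat.symm),
    ← Finset.sum_product']
  refine finsum_eq_sum_of_support_subset _ fun ij hi => ?_
  by_contra hK
  refine hi (h _ _ ?_)
  have : ij.1 < K → K ≤ ij.2 := by simpa using hK
  simp only [Equiv.pnatEquivNat_symm_apply, Nat.succPNat_coe, Nat.succ_eq_add_one]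
  omega

theorem succPNat_add (i j : ℕ) : i.succPNat + j.succPNat = (i + j + 1).succPNat := by
  apply PNat.coe_injective
  simp
  omega

/-- Only finitely many variables occur in $f$. The form "for all large $K$" lets several functions
share one truncation. -/
theorem opD'_eq_opTrunc (f : SymF) : ∀ᶠ K in atTop, opD' f = opTrunc K f := by
  obtain ⟨K₀, hK₀⟩ := eventually_pderiv_eq_zero f
  filter_upwards [eventually_ge_atTop K₀] with K hK
  have h0 : ∀ k : ℕ+, K < k → MvPolynomial.pderiv k f = 0 := fun k hk => hK₀ k (by omega)
  rw [opD', opD, opE, opTrunc_apply, finsum_pnat_prod_eq _ K, finsum_pnat_prod_eq _ K,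
    finsum_pnat_eq _ K, finsum_pnat_eq _ K]
  · congr 1
    simp only [Finset.smul_sum, Finset.sum_add_distrib]
    rw [add_sub_assoc, ← Finset.sum_sub_distrib]
    congr 1
    · congr 1
      · refine Finset.sum_congr rfl fun i _ => Finset.sum_congr rfl fun j _ => ?_
        rw [lower_apply, succPNat_add, p_succ, p_succ, mul_smul_comm]
        simp
      · refine Finset.sum_congr rfl fun i _ => Finset.sum_congr rfl fun j _ => ?_
        simp only [lower_apply, succPNat_add, p_succ, mul_smul_comm, Derivation.map_smul, smul_smul]
        congr 1
        simp
        ring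
    -- With $k=i+1$, $\alpha(\alpha-1)k^2-k\alpha=((\alpha-1)k-1)\,k\alpha$, and the factor
    -- $k\alpha$ belongs to `lower i`.
    · refine Finset.sum_congr rfl fun i _ => ?_
      simp only [lower_apply, p_succ, mul_smul_comm, smul_smul, ← sub_smul]
      congr 1
      simp
      ring
  · intro k hk; simp [h0 k hk]
  · intro k hk; simp [h0 k hk]
  · rintro k l (hk | hl)
    -- Commuting the derivatives puts the one with the large index innermost, where it kills $f$.
    · have hc : MvPolynomial.pderiv k (MvPolynomial.pderiv l f) =
          MvPolynomial.pderiv l (MvPolynomial.pderiv k f) := by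
        ext d
        simp only [MvPolynomial.coeff_pderiv]
        rw [add_right_comm]
        by_cases hkl : k = l
        · subst hkl; ring
        · simp [hkl, Ne.symm hkl]
          ring
      simp [hc, h0 k hk]
    · simp [h0 l hl]
  · intro k l h
    have : MvPolynomial.pderiv (k + l) f = 0 := h0 _ (by
      have := k.pos
      have := l.pos
      rw [PNat.add_coe]
      omega)
    simp [this]

/-- `D'(α)` as a linear map. -/
noncomputable def opLin : SymF →ₗ[F] SymF where
  toFun := opD'
  map_add' f g := by
    obtain ⟨K, h1, h2, h3⟩ := ((opD'_eq_opTrunc f).and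
      ((opD'_eq_opTrunc g).and (opD'_eq_opTrunc (f + g)))).exists
    rw [h1, h2, h3, map_add]
  map_smul' a f := by
    obtain ⟨K, h1, h2⟩ := ((opD'_eq_opTrunc f).and (opD'_eq_opTrunc (a • f))).exists
    rw [h1, h2, map_smul]
    rfl

theorem opLin_apply (f : SymF) : opLin f = opD' f := rfl

/-- The terms $p_ip_j\partial_{i+j}$ and $p_{i+j}\partial_i\partial_j$ are adjoint to each other
once the $\partial$'s are scaled as in `lower`; the terms $p_k\partial_k$ are self-adjoint. -/
theorem scalar_opTrunc (K : ℕ) (f g : SymF) :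
    scalar (opTrunc K f) g = scalar f (opTrunc K g) := by
  have h1 (i j : ℕ) : scalarBilin (p (i + 1) * p (j + 1) * lower (i + j + 1) f) g =
      scalarBilin f (p (i + j + 2) * lower i (lower j g)) := by
    simp only [scalarBilin_apply]
    rw [mul_assoc, scalar_p_mul, scalar_p_mul, scalar_lower_left, lower_comm]
  have h2 (i j : ℕ) : scalarBilin (p (i + j + 2) * lower i (lower j f)) g =
      scalarBilin f (p (i + 1) * p (j + 1) * lower (i + j + 1) g) := by
    simp only [scalarBilin_apply]
    rw [scalar_p_mul (i + j + 1), scalar_lower_left, scalar_lower_left, mul_assoc, mul_left_comm]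
  have h3 (i : ℕ) : scalarBilin (p (i + 1) * lower i f) g =
      scalarBilin f (p (i + 1) * lower i g) := by
    simp only [scalarBilin_apply]
    rw [scalar_p_mul, scalar_lower_left]
  rw [← scalarBilin_apply, ← scalarBilin_apply, opTrunc_apply, opTrunc_apply]
  simp only [map_smul, map_add, map_sum, LinearMap.smul_apply, LinearMap.add_apply,
    LinearMap.sum_apply, h1, h2, h3]
  have h4 (i j : ℕ) : scalarBilin f (p (i + j + 2) * lower i (lower j g)) +
      scalarBilin f (p (i + 1) * p (j + 1) * lower (i + j + 1) g) =
      scalarBilin f (p (i + 1) * p (j + 1) * lower (i + j + 1) g) +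
        scalarBilin f (p (i + j + 2) * lower i (lower j g)) := add_comm _ _
  simp only [h4]

/-- `D'(α)` is self-adjoint. -/
theorem scalar_opD' (f g : SymF) : scalar (opD' f) g = scalar f (opD' g) := by
  obtain ⟨K, h1, h2⟩ := ((opD'_eq_opTrunc f).and (opD'_eq_opTrunc g)).exists
  rw [h1, h2, scalar_opTrunc]

/-- The first order part `α⁻¹ ∑_{i, j} ij α² p_{i + j} (∂f/∂p_i) (∂g/∂p_j)` of `D'(α)(f g)`, with
the summation indices bounded by `K`. -/
noncomputable def cross (K : ℕ) (f g : SymF) : SymF :=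
  (al : F)⁻¹ • ∑ i ∈ Finset.range K, ∑ j ∈ Finset.range K,
    p (i + j + 2) * (lower i f * lower j g)

/-- Only the second order terms violate the Leibniz rule. Their two mixed contributions agree after
exchanging $i$ and $j$, which turns $(2\alpha)^{-1}$ into $\alpha^{-1}$. -/
theorem opTrunc_mul (K : ℕ) (f g : SymF) :
    opTrunc K (f * g) = opTrunc K f * g + f * opTrunc K g + cross K f g := by
  have hs : ∑ i ∈ Finset.range K, ∑ j ∈ Finset.range K,
      p (i + j + 2) * (lower j f * lower i g) =
      ∑ i ∈ Finset.range K, ∑ j ∈ Finset.range K, p (i + j + 2) * (lower i f * lower j g) := by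
    rw [Finset.sum_comm]
    simp only [add_comm]
  have hc : cross K f g = (2 * al : F)⁻¹ • (∑ i ∈ Finset.range K, ∑ j ∈ Finset.range K,
      (p (i + j + 2) * (lower i f * lower j g) + p (i + j + 2) * (lower j f * lower i g))) := by
    simp only [Finset.sum_add_distrib, hs]
    rw [cross, ← two_smul F, smul_smul, mul_inv, mul_right_comm,
      inv_mul_cancel₀ (two_ne_zero : (2 : F) ≠ 0), one_mul]
  rw [hc]
  simp only [opTrunc_apply, smul_mul_assoc, mul_smul_comm, ← smul_add]
  congr 1
  rw [add_mul, mul_add, add_add_add_comm, add_right_comm]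
  refine congrArg₂ (· + ·) ?_ ?_ <;>
    simp only [Finset.sum_mul, Finset.mul_sum, ← Finset.sum_add_distrib]
  · refine Finset.sum_congr rfl fun i _ => Finset.sum_congr rfl fun j _ => ?_
    simp only [Derivation.leibniz, map_add, smul_eq_mul]
    ring
  · refine Finset.sum_congr rfl fun i _ => ?_
    simp only [Derivation.leibniz, smul_eq_mul, smul_mul_assoc, mul_smul_comm, ← smul_add]
    congr 1
    ring

theorem cross_comm (K : ℕ) (f g : SymF) : cross K f g = cross K g f := by
  rw [cross, cross, Finset.sum_comm]
  simp only [add_comm, mul_comm]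

theorem cross_mul (K : ℕ) (f g h : SymF) :
    cross K f (g * h) = cross K f g * h + g * cross K f h := by
  simp only [cross, smul_mul_assoc, mul_smul_comm, ← smul_add, Finset.sum_mul, Finset.mul_sum,
    ← Finset.sum_add_distrib]
  congr 1
  refine Finset.sum_congr rfl fun i _ => Finset.sum_congr rfl fun j _ => ?_
  simp only [Derivation.leibniz, smul_eq_mul]
  ring

theorem cross_one (K : ℕ) (f : SymF) : cross K f 1 = 0 := by
  simp [cross]

theorem cross_prod (K : ℕ) (f : SymF) (g : ℕ → SymF) (s : Finset ℕ) :
    cross K f (∏ i ∈ s, g i) = ∑ i ∈ s, cross K f (g i) * ∏ l ∈ s.erase i, g l := by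
  induction s using Finset.induction_on with
  | empty => simp [cross_one]
  | insert a s ha ih =>
    rw [Finset.prod_insert ha, cross_mul, ih, Finset.sum_insert ha, Finset.erase_insert ha,
      Finset.mul_sum]
    congr 1
    refine Finset.sum_congr rfl fun i hi => ?_
    have hia : i ≠ a := fun h => ha (h ▸ hi)
    rw [Finset.erase_insert_of_ne hia.symm, Finset.prod_insert (by simp [ha])]
    ring

theorem opTrunc_one (K : ℕ) : opTrunc K 1 = 0 := by
  simp [opTrunc_apply]

/-- An operator of order two without constant term sees at most two factors at a time. -/
theorem opTrunc_prod (K : ℕ) (g : ℕ → SymF) (m : ℕ) :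
    opTrunc K (∏ i ∈ Finset.range m, g i) =
      ∑ j ∈ Finset.range m, opTrunc K (g j) * ∏ l ∈ (Finset.range m).erase j, g l +
      ∑ j ∈ Finset.range m, ∑ i ∈ Finset.range j,
        cross K (g i) (g j) * ∏ l ∈ ((Finset.range m).erase j).erase i, g l := by
  induction m with
  | zero => simp [opTrunc_one]
  | succ m ih =>
    have he : (Finset.range (m + 1)).erase m = Finset.range m := by
      rw [Finset.range_add_one, Finset.erase_insert Finset.notMem_range_self]
    rw [Finset.prod_range_succ, opTrunc_mul, ih, Finset.sum_range_succ, Finset.sum_range_succ _ m,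
      he, cross_comm, cross_prod, add_mul, Finset.sum_mul, Finset.sum_mul]
    have h1 : ∀ j ∈ Finset.range m, opTrunc K (g j) * ∏ l ∈ (Finset.range (m + 1)).erase j, g l =
        opTrunc K (g j) * (∏ l ∈ (Finset.range m).erase j, g l) * g m := fun j hj => by
      have hj := Finset.mem_range.1 hj
      rw [Finset.range_add_one, Finset.erase_insert_of_ne (by omega),
        Finset.prod_insert (by simp)]
      ring
    have h2 : ∀ j ∈ Finset.range m, ∑ i ∈ Finset.range j,
        cross K (g i) (g j) * ∏ l ∈ ((Finset.range (m + 1)).erase j).erase i, g l =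
        (∑ i ∈ Finset.range j,
          cross K (g i) (g j) * ∏ l ∈ ((Finset.range m).erase j).erase i, g l) * g m :=
      fun j hj => by
        have hj := Finset.mem_range.1 hj
        rw [Finset.sum_mul]
        refine Finset.sum_congr rfl fun i hi => ?_
        have hi := Finset.mem_range.1 hi
        rw [Finset.range_add_one, Finset.erase_insert_of_ne (by omega),
          Finset.erase_insert_of_ne (by omega), Finset.prod_insert (by simp)]
        ring
    rw [Finset.sum_congr rfl h1, Finset.sum_congr rfl h2]
    simp only [cross_comm K (g m)]
    ring

/-! ### The action of `D'(α)` on products of the `Q_n` -/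

theorem sum_range_eq_of_le {M : Type*} [AddCommMonoid M] {f : ℕ → M} {a K : ℕ} (h : a ≤ K)
    (hf : ∀ i, a ≤ i → f i = 0) : ∑ i ∈ Finset.range K, f i = ∑ i ∈ Finset.range a, f i := by
  refine (Finset.sum_subset (Finset.range_subset_range.2 h) fun i _ hi => hf i ?_).symm
  simpa using hi

theorem sum_p_mul_lower {K n : ℕ} (hK : n ≤ K) :
    ∑ j ∈ Finset.range K, p (j + 1) * lower j (qRow n) = ((n : F) * al) • qRow n := by
  rw [smul_qRow, sum_range_eq_of_le hK]
  · refine Finset.sum_congr rfl fun j hj => ?_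
    rw [lower_qRow, if_pos (by simpa using hj)]
  · intro j hj
    rw [lower_qRow, if_neg (by omega), mul_zero]

/-- Both sides lower the index by $(i+1)+(j+1)$. On a single $Q_n$ the second derivatives thus
reduce to first derivatives. -/
theorem lower_lower_qRow (i j n : ℕ) :
    lower j (lower i (qRow n)) = lower (i + j + 1) (qRow n) := by
  rw [lower_qRow, lower_qRow]
  split_ifs with h1 h2 h2
  · rw [lower_qRow, if_pos (by omega)]
    congr 1
    omega
  · rw [lower_qRow, if_neg (by omega)]
  · omega
  · exact map_zero _

/-- Exactly $m$ pairs have $i+j+1=m$; the vanishing of $g$ from $K$ on makes the truncation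
harmless. -/
theorem sum_range_sum_range_add {M : Type*} [AddCommMonoid M] (g : ℕ → M) (K : ℕ)
    (hg : ∀ m, K ≤ m → g m = 0) :
    ∑ i ∈ Finset.range K, ∑ j ∈ Finset.range K, g (i + j + 1) =
      ∑ m ∈ Finset.range K, m • g m := by
  have h : ∀ i, ∑ j ∈ Finset.range K, g (i + j + 1) =
      ∑ m ∈ Finset.range K, if i < m then g m else 0 := fun i => by
    rw [← sum_range_eq_of_le (f := fun m => if i < m then g m else 0)
      (Nat.le_add_right K (i + 1)) (fun m hm => by rw [hg m hm, ite_self]),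
      ← Finset.sum_filter]
    refine Finset.sum_bij (fun j _ => i + j + 1) ?_ ?_ ?_ ?_
    · intro j hj
      simp only [Finset.mem_filter, Finset.mem_range] at hj ⊢
      omega
    · intro a _ b _ hab
      omega
    · intro b hb
      simp only [Finset.mem_filter, Finset.mem_range] at hb
      exact ⟨b - (i + 1), by simp only [Finset.mem_range]; omega, by omega⟩
    · intro _ _
      rfl
  rw [Finset.sum_congr rfl fun i _ => h i, Finset.sum_comm]
  refine Finset.sum_congr rfl fun m hm => ?_
  rw [← Finset.sum_filter, Finset.sum_const]
  congr 1
  have : (Finset.range K).filter (fun i => i < m) = Finset.range m := by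
    ext i
    simp only [Finset.mem_filter, Finset.mem_range] at hm ⊢
    omega
  rw [this, Finset.card_range]

/-- All three kinds of terms become multiples of $p_{i+1}Q_{n-i-1}$. Their coefficients add up to
$n\alpha-2$, independent of $i$, and the Newton recursion sums the rest to $n\alpha Q_n$. -/
theorem opTrunc_qRow {K n : ℕ} (hK : n ≤ K) :
    opTrunc K (qRow n) = (al / 2 * (n : F) ^ 2 - n) • qRow n := by
  have h1 : ∀ i, ∑ j ∈ Finset.range K, p (i + 1) * p (j + 1) * lower (i + j + 1) (qRow n) =
      (((n : F) - ((i + 1 : ℕ) : F)) * al) • (p (i + 1) * lower i (qRow n)) := fun i => by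
    simp only [← lower_lower_qRow, mul_assoc]
    rw [← Finset.mul_sum, ← mul_smul_comm, lower_qRow]
    congr 1
    split_ifs with h
    · rw [sum_p_mul_lower (by omega), Nat.cast_sub h]
    · simp
  have h2 : ∑ i ∈ Finset.range K, ∑ j ∈ Finset.range K,
      p (i + j + 2) * lower i (lower j (qRow n)) =
      ∑ i ∈ Finset.range K, (i : F) • (p (i + 1) * lower i (qRow n)) := by
    simp only [lower_lower_qRow, Nat.cast_smul_eq_nsmul]
    rw [← sum_range_sum_range_add (fun m => p (m + 1) * lower m (qRow n))]
    · refine Finset.sum_congr rfl fun i _ => Finset.sum_congr rfl fun j _ => ?_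
      rw [add_comm j i]
    · intro m hm
      rw [lower_qRow, if_neg (by omega), mul_zero]
  rw [opTrunc_apply]
  simp only [Finset.sum_add_distrib, h1]
  rw [h2, ← Finset.sum_add_distrib, ← Finset.sum_add_distrib]
  have h3 : ∀ i ∈ Finset.range K,
      (((n : F) - ((i + 1 : ℕ) : F)) * al) • (p (i + 1) * lower i (qRow n)) +
      (i : F) • (p (i + 1) * lower i (qRow n)) +
      ((al - 1) * ((i + 1 : ℕ) : F) - 1) • (p (i + 1) * lower i (qRow n)) =
      ((n : F) * al - 2) • (p (i + 1) * lower i (qRow n)) := fun i _ => by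
    rw [← add_smul, ← add_smul]
    congr 1
    push_cast
    ring
  rw [Finset.sum_congr rfl h3, ← Finset.smul_sum, sum_p_mul_lower hK, smul_smul, smul_smul]
  congr 1
  field_simp [al_ne_zero]

theorem cross_qRow_eq {K a b : ℕ} (ha : a ≤ K) (hb : b ≤ K) :
    cross K (qRow a) (qRow b) = (al : F)⁻¹ • ∑ i ∈ Finset.range a, ∑ j ∈ Finset.range b,
      p (i + j + 2) * (qRow (a - (i + 1)) * qRow (b - (j + 1))) := by
  rw [cross, sum_range_eq_of_le ha]
  · refine congrArg _ ?_
    refine Finset.sum_congr rfl fun i hi => ?_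
    rw [sum_range_eq_of_le hb]
    · refine Finset.sum_congr rfl fun j hj => ?_
      rw [lower_qRow, lower_qRow, if_pos (by simpa using hi), if_pos (by simpa using hj)]
    · intro j hj
      rw [lower_qRow j, if_neg (by omega), mul_zero, mul_zero]
  · intro i hi
    refine Finset.sum_eq_zero fun j _ => ?_
    rw [lower_qRow i, if_neg (by omega), zero_mul, mul_zero]

/-- Both double sums are parts of the sum of $H$ over one $(a+1)\times(b+1)$ rectangle: one omits
the row $i=0$, the other the column $j=0$. The Newton recursion evaluates both omitted lines. -/
theorem cross_qRow_succ {K a b : ℕ} (ha : a + 1 ≤ K) (hb : b + 1 ≤ K) :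
    cross K (qRow a) (qRow (b + 1)) = cross K (qRow (a + 1)) (qRow b) +
      ((a + 1 : ℕ) : F) • (qRow (a + 1) * qRow b) -
      ((b + 1 : ℕ) : F) • (qRow a * qRow (b + 1)) := by
  let H (i j : ℕ) : SymF := p (i + j + 1) * (qRow (a - i) * qRow (b - j))
  have h1 : ∑ j ∈ Finset.range (b + 1), H 0 j =
      (((b + 1 : ℕ) : F) * al) • (qRow a * qRow (b + 1)) := by
    rw [← mul_smul_comm, smul_qRow, Finset.mul_sum]
    refine Finset.sum_congr rfl fun j _ => ?_
    simp only [H, zero_add, Nat.sub_zero, Nat.add_sub_add_right]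
    ring
  have h2 : ∑ i ∈ Finset.range (a + 1), H i 0 =
      (((a + 1 : ℕ) : F) * al) • (qRow (a + 1) * qRow b) := by
    rw [← smul_mul_assoc, smul_qRow, Finset.sum_mul]
    refine Finset.sum_congr rfl fun j _ => ?_
    simp only [H, add_zero, Nat.sub_zero, Nat.add_sub_add_right]
    ring
  have h3 : ∑ i ∈ Finset.range a, ∑ j ∈ Finset.range (b + 1), H (i + 1) j +
      (((b + 1 : ℕ) : F) * al) • (qRow a * qRow (b + 1)) =
      ∑ i ∈ Finset.range (a + 1), ∑ j ∈ Finset.range b, H i (j + 1) +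
      (((a + 1 : ℕ) : F) * al) • (qRow (a + 1) * qRow b) := by
    rw [← h1, ← h2, ← Finset.sum_range_succ' (fun i => ∑ j ∈ Finset.range (b + 1), H i j),
      ← Finset.sum_add_distrib]
    exact Finset.sum_congr rfl fun i _ => Finset.sum_range_succ' _ _
  rw [cross_qRow_eq (by omega) hb, cross_qRow_eq ha (by omega)]
  have e1 : ∀ i j, p (i + j + 2) * (qRow (a - (i + 1)) * qRow (b + 1 - (j + 1))) = H (i + 1) j :=
    fun i j => by simp only [H, Nat.add_sub_add_right, show i + 1 + j + 1 = i + j + 2 by omega]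
  have e2 : ∀ i j, p (i + j + 2) * (qRow (a + 1 - (i + 1)) * qRow (b - (j + 1))) = H i (j + 1) :=
    fun i j => by simp only [H, Nat.add_sub_add_right, show i + (j + 1) + 1 = i + j + 2 by omega]
  simp only [e1, e2]
  rw [eq_sub_of_add_eq h3, smul_sub, smul_add, smul_smul, smul_smul]
  congr 3 <;> field_simp [al_ne_zero]

/-- One unit at a time is passed from $b$ to $a$, down to $Q_0=1$, on which the cross term vanishes.
No order between $a$ and $b$ is needed. -/
theorem cross_qRow {K : ℕ} (a b : ℕ) (hK : a + b ≤ K) :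
    cross K (qRow a) (qRow b) = -((b : F) • (qRow a * qRow b)) +
      ∑ k ∈ Finset.range b, ((a : F) - b + 2 * (k + 1)) •
        (qRow (a + (k + 1)) * qRow (b - (k + 1))) := by
  induction b generalizing a with
  | zero => simp [qRow_zero, cross_one]
  | succ b ih =>
    rw [Finset.sum_range_succ']
    rcases Nat.lt_or_ge a K with ha | ha
    · rw [cross_qRow_succ ha (by omega), ih (a + 1) (by omega)]
      have : ∀ k ∈ Finset.range b, (((a + 1 : ℕ) : F) - b + 2 * (k + 1)) •
          (qRow (a + 1 + (k + 1)) * qRow (b - (k + 1))) =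
          ((a : F) - ((b + 1 : ℕ) : F) + 2 * (((k + 1 : ℕ) : F) + 1)) •
          (qRow (a + (k + 1 + 1)) * qRow (b + 1 - (k + 1 + 1))) := fun k _ => by
        rw [Nat.add_sub_add_right, show a + 1 + (k + 1) = a + (k + 1 + 1) by omega]
        congr 1
        push_cast
        ring
      rw [Finset.sum_congr rfl this]
      simp only [zero_add, Nat.add_sub_cancel]
      push_cast
      -- The new move of one square collects $a+1$ from the boundary term and $-b$ from the diagonal
      -- term of the induction hypothesis.
      rw [show (a : F) - (b + 1) + 2 * (0 + 1) = (a + 1) - b by ring, sub_smul]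
      abel
    · omega

/-- The factor at position $j$, counted from $0$, contributes $-v_j$ on its own and $-v_j$ for each
of its $j$ predecessors. This is the origin of $-\sum_i i\lambda_i$ in $e'_\lambda$. -/
theorem opTrunc_prod_qRow {K : ℕ} (v : ℕ → ℕ) (m : ℕ)
    (hK : ∀ i ∈ Finset.range m, 2 * v i ≤ K) (R : SymF)
    (hR : ∏ i ∈ Finset.range m, qRow (v i) = R) :
    opTrunc K R =
      (al / 2 * ∑ i ∈ Finset.range m, (v i : F) ^ 2 -
        ∑ i ∈ Finset.range m, ((i : F) + 1) * (v i : F)) • R +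
      ∑ j ∈ Finset.range m, ∑ i ∈ Finset.range j, ∑ k ∈ Finset.range (v j),
        ((v i : F) - v j + 2 * (k + 1)) • (qRow (v i + (k + 1)) * qRow (v j - (k + 1)) *
          ∏ l ∈ ((Finset.range m).erase j).erase i, qRow (v l)) := by
  have e1 : ∀ j ∈ Finset.range m, opTrunc K (qRow (v j)) *
      ∏ l ∈ (Finset.range m).erase j, qRow (v l) = (al / 2 * (v j : F) ^ 2 - v j) • R :=
    fun j hj => by
      rw [opTrunc_qRow (by have := hK j hj; omega), smul_mul_assoc,
        Finset.mul_prod_erase _ (fun l => qRow (v l)) hj, hR]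
  have e2 : ∀ j ∈ Finset.range m, ∑ i ∈ Finset.range j, cross K (qRow (v i)) (qRow (v j)) *
      ∏ l ∈ ((Finset.range m).erase j).erase i, qRow (v l) = -((j : F) * v j) • R +
      ∑ i ∈ Finset.range j, ∑ k ∈ Finset.range (v j),
        ((v i : F) - v j + 2 * (k + 1)) • (qRow (v i + (k + 1)) * qRow (v j - (k + 1)) *
          ∏ l ∈ ((Finset.range m).erase j).erase i, qRow (v l)) := fun j hj => by
    have e3 : -((j : F) * v j) • R = ∑ i ∈ Finset.range j, -((v j : F) • R) := by
      rw [Finset.sum_const, Finset.card_range, ← Nat.cast_smul_eq_nsmul F, smul_neg, smul_smul,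
        neg_smul]
    rw [e3, ← Finset.sum_add_distrib]
    refine Finset.sum_congr rfl fun i hi => ?_
    have hij := Finset.mem_range.1 hi
    have hi : i ∈ (Finset.range m).erase j := by
      simp only [Finset.mem_erase, Finset.mem_range] at hj ⊢
      omega
    have := hK j hj
    have := hK i (Finset.mem_of_mem_erase hi)
    rw [cross_qRow _ _ (by omega), add_mul, Finset.sum_mul, neg_mul, smul_mul_assoc,
      mul_right_comm, Finset.mul_prod_erase _ (fun l => qRow (v l)) hi, mul_comm,
      Finset.mul_prod_erase _ (fun l => qRow (v l)) hj, hR]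
    simp only [smul_mul_assoc]
  rw [← hR, opTrunc_prod, Finset.sum_congr rfl e1, Finset.sum_congr rfl e2,
    Finset.sum_add_distrib, ← add_assoc, ← Finset.sum_smul, ← Finset.sum_smul, ← add_smul, hR]
  refine congrArg₂ (· + ·) (congrArg (· • R) ?_) rfl
  rw [Finset.mul_sum, ← Finset.sum_sub_distrib, ← Finset.sum_add_distrib]
  exact Finset.sum_congr rfl fun i _ => by ring

theorem opD'_prod_qRow (v : ℕ → ℕ) (m : ℕ) :
    opD' (∏ i ∈ Finset.range m, qRow (v i)) =
      (al / 2 * ∑ i ∈ Finset.range m, (v i : F) ^ 2 -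
        ∑ i ∈ Finset.range m, ((i : F) + 1) * (v i : F)) • ∏ i ∈ Finset.range m, qRow (v i) +
      ∑ j ∈ Finset.range m, ∑ i ∈ Finset.range j, ∑ k ∈ Finset.range (v j),
        ((v i : F) - v j + 2 * (k + 1)) • (qRow (v i + (k + 1)) * qRow (v j - (k + 1)) *
          ∏ l ∈ ((Finset.range m).erase j).erase i, qRow (v l)) := by
  obtain ⟨K, h1, hK⟩ := ((opD'_eq_opTrunc (∏ i ∈ Finset.range m, qRow (v i))).and
    (eventually_ge_atTop (2 * ∑ i ∈ Finset.range m, v i))).exists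
  rw [h1]
  refine opTrunc_prod_qRow v m (fun i hi => ?_) _ rfl
  exact (Nat.mul_le_mul_left 2
    (Finset.single_le_sum (f := v) (fun _ _ => Nat.zero_le _) hi)).trans hK

/-! ### Parts of a partition -/

section Parts

variable {n : ℕ}

theorem part_antitone (lam : n.Partition) : Antitone (part lam) := fun i j hij => by
  unfold part
  rcases Nat.lt_or_ge j (lam.parts.sort (· ≥ ·)).length with hj | hj
  · rw [List.getD_eq_getElem _ _ hj, List.getD_eq_getElem _ _ (by omega)]
    rcases hij.eq_or_lt with rfl | hij
    · rfl
    · exact List.pairwise_iff_getElem.1 (Multiset.pairwise_sort lam.parts (· ≥ ·)) i j _ hj hij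
  · rw [List.getD_eq_default _ _ hj]
    exact Nat.zero_le _

theorem card_parts_le (lam : n.Partition) : lam.parts.card ≤ n := by
  have := Multiset.card_nsmul_le_sum (s := lam.parts) (a := 1) fun x hx => lam.parts_pos hx
  simpa [lam.parts_sum] using this

theorem part_eq_zero (lam : n.Partition) {i : ℕ} (hi : n ≤ i) : part lam i = 0 :=
  List.getD_eq_default _ _ (by simpa using (card_parts_le lam).trans hi)

theorem lt_of_part_ne_zero (lam : n.Partition) {i : ℕ} (hi : part lam i ≠ 0) : i < n := by
  by_contra h
  exact hi (part_eq_zero lam (not_lt.1 h))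

/-- Padding with empty rows gives all partitions of $n$ the same number of rows; it does not affect
products because $Q_0=1$. -/
theorem map_part_range (lam : n.Partition) {m : ℕ} (hm : n ≤ m) :
    (Finset.range m).val.map (part lam) =
      lam.parts + Multiset.replicate (m - lam.parts.card) 0 := by
  have hl : (lam.parts.sort (· ≥ ·)).length = lam.parts.card := Multiset.length_sort _
  have hc := (card_parts_le lam).trans hm
  have : (List.range m).map (part lam) =
      lam.parts.sort (· ≥ ·) ++ List.replicate (m - lam.parts.card) 0 := by
    apply List.ext_getElem
    · simp
      omega
    · intro i h1 h2
      simp only [List.getElem_map, List.getElem_range, part]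
      rcases Nat.lt_or_ge i (lam.parts.sort (· ≥ ·)).length with hi | hi
      · rw [List.getElem_append_left hi, List.getD_eq_getElem _ _ hi]
      · rw [List.getElem_append_right hi, List.getD_eq_default _ _ hi, List.getElem_replicate]
  have h2 := congrArg (fun l : List ℕ => (l : Multiset ℕ)) this
  simp only [← Multiset.coe_add, Multiset.sort_eq, Multiset.coe_replicate] at h2
  exact h2

theorem filter_parts (lam : n.Partition) : lam.parts.filter (· ≠ 0) = lam.parts :=
  Multiset.filter_eq_self.2 fun _ hx => (lam.parts_pos hx).ne'

theorem filter_replicate_zero (m : ℕ) :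
    (Multiset.replicate m 0).filter (· ≠ 0) = (0 : Multiset ℕ) :=
  Multiset.filter_eq_nil.2 fun x hx => by simp [Multiset.eq_of_mem_replicate hx]

theorem filter_map_part (lam : n.Partition) :
    ((Finset.range n).val.map (part lam)).filter (· ≠ 0) = lam.parts := by
  rw [map_part_range lam le_rfl, Multiset.filter_add, filter_replicate_zero, add_zero,
    filter_parts]

theorem part_injective : Function.Injective (part (n := n)) := fun lam mu h => by
  apply Nat.Partition.ext
  rw [← filter_map_part lam, h, filter_map_part]

theorem sum_part (lam : n.Partition) {m : ℕ} (hm : n ≤ m) :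
    ∑ i ∈ Finset.range m, part lam i = n := by
  have := congrArg Multiset.sum (map_part_range lam hm)
  rw [Multiset.sum_add, Multiset.sum_replicate, smul_zero, add_zero, lam.parts_sum] at this
  exact this

theorem count_parts (lam : n.Partition) {x : ℕ} (hx : x ≠ 0) :
    lam.parts.count x = ((Finset.range n).filter fun i => part lam i = x).card := by
  have := congrArg (Multiset.count x) (map_part_range lam le_rfl)
  rw [Multiset.count_add, Multiset.count_replicate, if_neg hx.symm, add_zero,
    Multiset.count_map] at this
  rw [← this]
  simp only [eq_comm (a := x)]
  rfl

theorem prod_map_filter_ne_zero {M : Type*} [CommMonoid M] (g : ℕ → M) (hg : g 0 = 1)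
    (s : Multiset ℕ) : ((s.filter (· ≠ 0)).map g).prod = (s.map g).prod := by
  induction s using Multiset.induction_on with
  | empty => simp
  | cons a s ih =>
    by_cases ha : a = 0
    · subst ha
      rw [Multiset.filter_cons_of_neg (p := (· ≠ 0)) s (by simp), ih, Multiset.map_cons, Multiset.prod_cons, hg,
        one_mul]
    · rw [Multiset.filter_cons_of_pos (p := (· ≠ 0)) s ha, Multiset.map_cons, Multiset.map_cons,
        Multiset.prod_cons, Multiset.prod_cons, ih]

theorem q_eq_prod (lam : n.Partition) : q lam = ∏ i ∈ Finset.range n, qRow (part lam i) := by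
  rw [q, ← filter_map_part lam, prod_map_filter_ne_zero _ qRow_zero, Multiset.map_map]
  rfl

theorem sum_le_sum_getD (l : List ℕ) (hl : l.Pairwise (· ≥ ·)) (t : Multiset ℕ)
    (ht : t ≤ (l : Multiset ℕ)) (m : ℕ) (hm : t.card ≤ m) :
    t.sum ≤ ∑ j ∈ Finset.range m, l.getD j 0 := by
  induction l generalizing t m with
  | nil =>
    have : t = 0 := by simpa using ht
    simp [this]
  | cons a l ih =>
    rw [List.pairwise_cons] at hl
    by_cases ht0 : t = 0
    · simp [ht0]
    have hm0 : 0 < m := (Multiset.card_pos.2 ht0).trans_le hm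
    obtain ⟨m, rfl⟩ := Nat.exists_eq_succ_of_ne_zero hm0.ne'
    -- The element removed from $t$ is the head $a$ if it occurs, and any element otherwise, so that
    -- the remainder lies in the tail.
    have key : ∃ b u, t = b ::ₘ u ∧ b ≤ a ∧ u ≤ (l : Multiset ℕ) := by
      by_cases ha : a ∈ t
      · obtain ⟨u, rfl⟩ := Multiset.exists_cons_of_mem ha
        exact ⟨a, u, rfl, le_rfl, (Multiset.cons_le_cons_iff a).1 ht⟩
      · have ht' : t ≤ (l : Multiset ℕ) := (Multiset.le_cons_of_notMem ha).1 ht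
        obtain ⟨b, hb⟩ := Multiset.exists_mem_of_ne_zero ht0
        obtain ⟨u, rfl⟩ := Multiset.exists_cons_of_mem hb
        exact ⟨b, u, rfl, hl.1 b (Multiset.mem_of_le ht' hb),
          (Multiset.le_cons_self u b).trans ht'⟩
    obtain ⟨b, u, rfl, hb, hu⟩ := key
    rw [Multiset.card_cons] at hm
    rw [Multiset.sum_cons, Finset.sum_range_succ', add_comm]
    exact add_le_add (ih hl.2 u hu m (by omega)) hb

theorem sum_le_sum_part (mu : n.Partition) (s T : Finset ℕ) (hT : T ⊆ s) (v : ℕ → ℕ)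
    (hv : (s.val.map v).filter (· ≠ 0) = mu.parts) :
    ∑ i ∈ T, v i ≤ ∑ j ∈ Finset.range T.card, part mu j := by
  have h1 : ((T.val.map v).filter (· ≠ 0)).sum = ∑ i ∈ T, v i := by
    have := prod_map_filter_ne_zero (M := Multiplicative ℕ) Multiplicative.ofAdd rfl (T.val.map v)
    have h := congrArg Multiplicative.toAdd this
    rw [← ofAdd_multiset_prod, ← ofAdd_multiset_prod] at h
    exact h
  rw [← h1]
  refine sum_le_sum_getD _ (Multiset.pairwise_sort mu.parts (· ≥ ·)) _ ?_ _ ?_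
  · rw [Multiset.sort_eq, ← hv]
    exact Multiset.filter_le_filter _ (Multiset.map_le_map (Finset.val_le_iff.2 hT))
  · refine (Multiset.card_le_card (Multiset.filter_le _ _)).trans ?_
    simp

/-! ### Orders on partitions -/

theorem domLE_refl (lam : n.Partition) : DomLE lam lam := fun _ => le_rfl

theorem DomLE.trans {lam mu nu : n.Partition} (h1 : DomLE lam mu) (h2 : DomLE mu nu) :
    DomLE lam nu := fun i => (h1 i).trans (h2 i)

theorem DomLE.antisymm {lam mu : n.Partition} (h1 : DomLE lam mu) (h2 : DomLE mu lam) :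
    lam = mu := by
  have h (i : ℕ) := (h1 i).antisymm (h2 i)
  refine part_injective (funext fun i => ?_)
  have := h (i + 1)
  rw [Finset.sum_range_succ, Finset.sum_range_succ, h i] at this
  omega

/-- At the first row where the partitions differ, the partial sums differ by exactly that row. -/
theorem DomLE.lexLT {lam mu : n.Partition} (h : DomLE lam mu) (hne : lam ≠ mu) :
    LexLT lam mu := by
  classical
  have hex : ∃ i, part lam i ≠ part mu i := by
    by_contra! hc
    exact hne (part_injective (funext hc))
  have heq : ∀ j < Nat.find hex, part lam j = part mu j := fun j hj =>
    not_not.1 (Nat.find_min hex hj)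
  refine ⟨Nat.find hex, heq, lt_of_le_of_ne ?_ (Nat.find_spec hex)⟩
  have := h (Nat.find hex + 1)
  rw [Finset.sum_range_succ, Finset.sum_range_succ,
    Finset.sum_congr rfl fun j hj => heq j (Finset.mem_range.1 hj)] at this
  exact le_of_add_le_add_left this

theorem LexLT.asymm {lam mu : n.Partition} (h1 : LexLT lam mu) (h2 : LexLT mu lam) : False := by
  obtain ⟨i, hi, hi'⟩ := h1
  obtain ⟨j, hj, hj'⟩ := h2
  rcases lt_trichotomy i j with h | rfl | h
  · rw [hj i h] at hi'
    exact lt_irrefl _ hi'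
  · exact lt_asymm hi' hj'
  · rw [hi j h] at hj'
    exact lt_irrefl _ hj'

/-- The number `∑_i i λ_i`. -/
def rowSum (lam : n.Partition) : ℕ := ∑ i ∈ Finset.range n, (i + 1) * part lam i

theorem sum_mul_add_sum_sum (a : ℕ → ℕ) (m : ℕ) :
    ∑ i ∈ Finset.range m, (i + 1) * a i + ∑ i ∈ Finset.range m, ∑ j ∈ Finset.range i, a j =
      m * ∑ j ∈ Finset.range m, a j := by
  induction m with
  | zero => simp
  | succ m ih =>
    rw [Finset.sum_range_succ, Finset.sum_range_succ _ m, Finset.sum_range_succ a]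
    linarith

/-- Summation by parts writes `rowSum` as a constant minus the sum of the partial sums that define
dominance. -/
theorem DomLE.rowSum_lt {lam mu : n.Partition} (h : DomLE lam mu) (hne : lam ≠ mu) :
    rowSum mu < rowSum lam := by
  have h1 := sum_mul_add_sum_sum (part lam) n
  have h2 := sum_mul_add_sum_sum (part mu) n
  rw [sum_part lam le_rfl] at h1
  rw [sum_part mu le_rfl] at h2
  have h3 : ∑ i ∈ Finset.range n, ∑ j ∈ Finset.range i, part lam j <
      ∑ i ∈ Finset.range n, ∑ j ∈ Finset.range i, part mu j := by
    refine Finset.sum_lt_sum (fun i _ => h i) ?_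
    by_contra! hc
    refine hne (h.antisymm fun i => ?_)
    rcases Nat.lt_or_ge i n with hi | hi
    · exact hc i (Finset.mem_range.2 hi)
    · rw [sum_part _ hi, sum_part _ hi]
  unfold rowSum
  omega

theorem e'_eq (lam : n.Partition) :
    e' lam = al / 2 * ((∑ i ∈ Finset.range n, part lam i ^ 2 : ℕ) : F) - (rowSum lam : F) := by
  simp [e', rowSum]

theorem nat_eq_of_mul_al_sub_eq {a a' b b' : ℕ}
    (h : (al / 2 * (a : F) - (b : F)) = al / 2 * (a' : F) - (b' : F)) : b = b' := by
  have h1 : al * (a : F) + 2 * (b' : F) = al * (a' : F) + 2 * (b : F) := by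
    linear_combination 2 * h
  have h2 : algebraMap (Polynomial ℚ) F (Polynomial.X * (a : Polynomial ℚ) + 2 * (b' : Polynomial ℚ)) =
      algebraMap (Polynomial ℚ) F (Polynomial.X * (a' : Polynomial ℚ) + 2 * (b : Polynomial ℚ)) := by
    simpa [map_ofNat] using h1
  -- As $\alpha$ is an indeterminate, constant terms can be compared.
  have h3 := congrArg (fun f => Polynomial.eval 0 f) (RatFunc.algebraMap_injective ℚ h2)
  simp at h3
  exact h3.symm

theorem DomLE.e'_ne {lam mu : n.Partition} (h : DomLE lam mu) (hne : lam ≠ mu) :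
    e' mu ≠ e' lam := fun he => by
  rw [e'_eq, e'_eq] at he
  exact (h.rowSum_lt hne).ne (nat_eq_of_mul_al_sub_eq he)

end Parts

/-! ### Raising squares -/

section Moves

variable {n : ℕ}

/-- The rows of `λ` after moving `k` squares from row `j` to row `i`, before rearranging. -/
def moveRow (lam : n.Partition) (i j k l : ℕ) : ℕ :=
  if l = i then part lam i + k else if l = j then part lam j - k else part lam l

theorem map_range_eq_cons (f : ℕ → ℕ) {i j : ℕ} (hij : i < j) (hj : j < n) :
    (Finset.range n).val.map f =
      f i ::ₘ f j ::ₘ (((Finset.range n).erase j).erase i).val.map f := by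
  have hi : i ∈ (Finset.range n).erase j := by simp; omega
  have h1 : f i ::ₘ (((Finset.range n).erase j).erase i).val.map f =
      ((Finset.range n).erase j).val.map f := by
    rw [← Multiset.map_cons, Finset.erase_val, Multiset.cons_erase hi]
  have h2 : f j ::ₘ ((Finset.range n).erase j).val.map f = (Finset.range n).val.map f := by
    rw [← Multiset.map_cons, Finset.erase_val, Multiset.cons_erase (Finset.mem_range.2 hj)]
  rw [Multiset.cons_swap, h1, h2]

theorem erase_erase_parts (lam : n.Partition) {i j : ℕ} (hij : i < j) (hj : part lam j ≠ 0) :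
    (lam.parts.erase (part lam i)).erase (part lam j) =
      ((((Finset.range n).erase j).erase i).val.map (part lam)).filter (· ≠ 0) := by
  have hi : part lam i ≠ 0 :=
    ((Nat.pos_of_ne_zero hj).trans_le (part_antitone lam hij.le)).ne'
  have h := congrArg (Multiset.filter (· ≠ 0))
    (map_range_eq_cons (part lam) hij (lt_of_part_ne_zero lam hj))
  rw [filter_map_part, Multiset.filter_cons_of_pos (p := (· ≠ 0)) _ hi,
    Multiset.filter_cons_of_pos (p := (· ≠ 0)) _ hj] at h
  rw [h, Multiset.erase_cons_head, Multiset.erase_cons_head]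

theorem parts_eq_cons_cons (lam : n.Partition) {i j : ℕ} (hij : i < j) (hj : part lam j ≠ 0) :
    lam.parts = part lam i ::ₘ part lam j ::ₘ
      (lam.parts.erase (part lam i)).erase (part lam j) := by
  have hi : part lam i ≠ 0 :=
    ((Nat.pos_of_ne_zero hj).trans_le (part_antitone lam hij.le)).ne'
  have h := congrArg (Multiset.filter (· ≠ 0))
    (map_range_eq_cons (part lam) hij (lt_of_part_ne_zero lam hj))
  rwa [filter_map_part, Multiset.filter_cons_of_pos (p := (· ≠ 0)) _ hi,
    Multiset.filter_cons_of_pos (p := (· ≠ 0)) _ hj, ← erase_erase_parts lam hij hj] at h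

theorem map_moveRow (lam : n.Partition) {i j : ℕ} (k : ℕ) (hij : i < j) (hj : part lam j ≠ 0) :
    (Finset.range n).val.map (moveRow lam i j k) =
      (((Finset.range n).erase j).erase i).val.map (part lam) +
        {part lam i + k, part lam j - k} := by
  rw [map_range_eq_cons _ hij (lt_of_part_ne_zero lam hj)]
  have h1 : moveRow lam i j k i = part lam i + k := by simp [moveRow]
  have h2 : moveRow lam i j k j = part lam j - k := by simp [moveRow, hij.ne']
  have h3 : (((Finset.range n).erase j).erase i).val.map (moveRow lam i j k) =
      (((Finset.range n).erase j).erase i).val.map (part lam) := by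
    refine Multiset.map_congr rfl fun l hl => ?_
    have hl : l ∈ ((Finset.range n).erase j).erase i := hl
    simp only [Finset.mem_erase] at hl
    simp [moveRow, hl.1, hl.2.1]
  rw [h1, h2, h3, Multiset.insert_eq_cons, Multiset.add_cons, ← Multiset.singleton_add,
    ← Multiset.singleton_add, add_comm _ {part lam j - k}, ← Multiset.singleton_add]

theorem filter_map_moveRow (lam : n.Partition) {i j : ℕ} (k : ℕ) (hij : i < j)
    (hj : part lam j ≠ 0) :
    ((Finset.range n).val.map (moveRow lam i j k)).filter (· ≠ 0) =
      (((lam.parts.erase (part lam i)).erase (part lam j)) +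
        {part lam i + k, part lam j - k}).filter (· ≠ 0) := by
  rw [map_moveRow lam k hij hj, erase_erase_parts lam hij hj, Multiset.filter_add,
    Multiset.filter_add, Multiset.filter_filter]
  simp

theorem exists_isMoveUp (lam : n.Partition) {i j k : ℕ} (hij : i < j) (hk : 0 < k)
    (hkj : k ≤ part lam j) : ∃ mu, IsMoveUp lam i j k mu := by
  have hj : part lam j ≠ 0 := by omega
  refine ⟨Nat.Partition.ofSums n ((Finset.range n).val.map (moveRow lam i j k)) ?_,
    hij, hk, hkj, filter_map_moveRow lam k hij hj⟩
  rw [map_moveRow lam k hij hj]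
  have h1 := congrArg Multiset.sum
    (map_range_eq_cons (part lam) hij (lt_of_part_ne_zero lam hj))
  have h2 : ((Finset.range n).val.map (part lam)).sum = n := sum_part lam le_rfl
  rw [h2] at h1
  simp only [Multiset.sum_cons, Multiset.sum_add, Multiset.insert_eq_cons,
    Multiset.sum_singleton] at h1 ⊢
  omega

theorem IsMoveUp.unique {lam mu nu : n.Partition} {i j k : ℕ} (h1 : IsMoveUp lam i j k mu)
    (h2 : IsMoveUp lam i j k nu) : mu = nu :=
  Nat.Partition.ext (h1.2.2.2.trans h2.2.2.2.symm)

theorem IsMoveUp.q_eq {lam mu : n.Partition} {i j k : ℕ} (h : IsMoveUp lam i j k mu) :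
    q mu = qRow (part lam i + k) * qRow (part lam j - k) *
      ∏ l ∈ ((Finset.range n).erase j).erase i, qRow (part lam l) := by
  have hj : part lam j ≠ 0 := by have := h.2.1; have := h.2.2.1; omega
  rw [q, h.2.2.2, ← filter_map_moveRow lam k h.1 hj, prod_map_filter_ne_zero _ qRow_zero,
    map_moveRow lam k h.1 hj, Multiset.map_add, Multiset.prod_add, Multiset.map_map, mul_comm,
    Multiset.insert_eq_cons, Multiset.map_cons, Multiset.map_singleton, Multiset.prod_cons,
    Multiset.prod_singleton]
  rfl

/-- Moving squares to an earlier row does not decrease the sum of the first $m$ rows, and neither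
does sorting the rows. -/
theorem IsMoveUp.domLE {lam mu : n.Partition} {i j k : ℕ} (h : IsMoveUp lam i j k mu) :
    DomLE lam mu := by
  have hj : part lam j ≠ 0 := by have := h.2.1; have := h.2.2.1; omega
  have hjn := lt_of_part_ne_zero lam hj
  intro m
  have hmain : ∀ m ≤ n, ∑ l ∈ Finset.range m, part lam l ≤ ∑ l ∈ Finset.range m, part mu l := by
    intro m hm
    have h1 := sum_le_sum_part mu (Finset.range n) (Finset.range m)
      (Finset.range_subset_range.2 hm) (moveRow lam i j k)
      ((filter_map_moveRow lam k h.1 hj).trans h.2.2.2.symm)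
    rw [Finset.card_range] at h1
    refine le_trans ?_ h1
    have h2 : ∀ l, part lam l + (if l = i then k else 0) =
        moveRow lam i j k l + (if l = j then k else 0) := fun l => by
      have := h.1
      have := h.2.2.1
      unfold moveRow
      split_ifs <;> subst_vars <;> omega
    have h3 := Finset.sum_congr rfl fun l (_ : l ∈ Finset.range m) => h2 l
    rw [Finset.sum_add_distrib, Finset.sum_add_distrib, Finset.sum_ite_eq', Finset.sum_ite_eq']
      at h3
    have := h.1
    simp only [Finset.mem_range] at h3
    split_ifs at h3 <;> omega
  rcases Nat.le_total m n with hm | hm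
  · exact hmain m hm
  · rw [sum_part _ hm, sum_part _ hm]

/-- The move without `erase`, so that multisets can be cancelled; the filter drops row $j$ if it
becomes empty. -/
theorem IsMoveUp.cons_eq {lam mu : n.Partition} {i j k : ℕ} (h : IsMoveUp lam i j k mu) :
    part lam i ::ₘ part lam j ::ₘ mu.parts =
      (part lam i + k) ::ₘ (({part lam j - k} : Multiset ℕ).filter (· ≠ 0) + lam.parts) := by
  have hj : part lam j ≠ 0 := by have := h.2.1; have := h.2.2.1; omega
  have h0 : ((lam.parts.erase (part lam i)).erase (part lam j)).filter (· ≠ 0) =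
      (lam.parts.erase (part lam i)).erase (part lam j) := by
    rw [erase_erase_parts lam h.1 hj, Multiset.filter_filter]
    simp
  have h1 : part lam i + k ≠ 0 := by have := h.2.1; omega
  rw [h.2.2.2, Multiset.filter_add, h0, Multiset.insert_eq_cons,
    Multiset.filter_cons_of_pos (p := (· ≠ 0)) _ h1]
  conv_rhs => rw [parts_eq_cons_cons lam h.1 hj]
  simp only [← Multiset.singleton_add]
  abel

theorem IsMoveUp.ne {lam mu : n.Partition} {i j k : ℕ} (h : IsMoveUp lam i j k mu) :
    mu ≠ lam := by
  rintro rfl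
  have h1 := h.cons_eq
  rw [← Multiset.cons_add, ← Multiset.singleton_add, ← Multiset.singleton_add,
    ← add_assoc] at h1
  have h2 := add_right_cancel h1
  have h3 : part mu i + k ∈ ({part mu i} + {part mu j} : Multiset ℕ) := by rw [h2]; simp
  have := part_antitone mu h.1.le
  have := h.2.1
  simp at h3
  omega

/-- Cancelling $\lambda$ and $\mu$ between the two descriptions leaves an equality of multisets with
at most four elements. Comparing largest elements, and cancelling them, identifies first
$\lambda_i+k$, then $\lambda_i$, then $\lambda_j$. -/
theorem IsMoveUp.values_eq {lam mu : n.Partition} {i j k i' j' k' : ℕ}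
    (h : IsMoveUp lam i j k mu) (h' : IsMoveUp lam i' j' k' mu) :
    part lam i = part lam i' ∧ part lam j = part lam j' ∧ k = k' := by
  have e : (part lam i' ::ₘ part lam j' ::ₘ
      (part lam i + k) ::ₘ ({part lam j - k} : Multiset ℕ).filter (· ≠ 0)) =
      (part lam i ::ₘ part lam j ::ₘ
      (part lam i' + k') ::ₘ ({part lam j' - k'} : Multiset ℕ).filter (· ≠ 0)) := by
    have h1 := h.cons_eq
    have h2 := h'.cons_eq
    apply add_right_cancel (b := lam.parts + mu.parts)
    simp only [← Multiset.singleton_add] at h1 h2 ⊢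
    calc _ = ({part lam i'} + ({part lam j'} + mu.parts)) + ({part lam i + k} +
          (({part lam j - k} : Multiset ℕ).filter (· ≠ 0) + lam.parts)) := by abel
      _ = _ := by rw [← h1, h2]; abel
  have := part_antitone lam h.1.le
  have := part_antitone lam h'.1.le
  have := h.2.1
  have := h'.2.1
  have := h.2.2.1
  have := h'.2.2.1
  generalize part lam i = a at *
  generalize part lam j = b at *
  generalize part lam i' = a' at *
  generalize part lam j' = b' at *
  have m1 (x : ℕ) := congrArg (x ∈ ·) e
  simp only [Multiset.mem_cons, Multiset.mem_filter, Multiset.mem_singleton, eq_iff_iff] at m1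
  have hs : a + k = a' + k' := by
    have := m1 (a + k)
    have := m1 (a' + k')
    omega
  have e2 : (a' ::ₘ b' ::ₘ ({b - k} : Multiset ℕ).filter (· ≠ 0)) =
      (a ::ₘ b ::ₘ ({b' - k'} : Multiset ℕ).filter (· ≠ 0)) := by
    apply (Multiset.cons_inj_right (a + k)).1
    rw [hs] at e ⊢
    simp only [← Multiset.singleton_add] at e ⊢
    calc _ = {a'} + ({b'} + ({a' + k'} + ({b - k} : Multiset ℕ).filter (· ≠ 0))) := by abel
      _ = _ := by rw [e]; abel
  have m2 (x : ℕ) := congrArg (x ∈ ·) e2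
  simp only [Multiset.mem_cons, Multiset.mem_filter, Multiset.mem_singleton, eq_iff_iff] at m2
  have ha : a = a' := by
    have := m2 a
    have := m2 a'
    omega
  subst ha
  have e3 := (Multiset.cons_inj_right a).1 e2
  have m3 (x : ℕ) := congrArg (x ∈ ·) e3
  simp only [Multiset.mem_cons, Multiset.mem_filter, Multiset.mem_singleton, eq_iff_iff] at m3
  have := m3 b
  have := m3 b'
  omega

theorem isMoveUp_iff {lam mu : n.Partition} {i₀ j₀ k₀ : ℕ} (h : IsMoveUp lam i₀ j₀ k₀ mu)
    {i j k : ℕ} (hij : i < j) : IsMoveUp lam i j k mu ↔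
      part lam i = part lam i₀ ∧ part lam j = part lam j₀ ∧ k = k₀ := by
  refine ⟨fun h' => h'.values_eq h, ?_⟩
  rintro ⟨h1, h2, rfl⟩
  refine ⟨hij, h.2.1, h2 ▸ h.2.2.1, ?_⟩
  rw [h.2.2.2, h1, h2]

/-! ### Counting the moves with a given result -/

theorem two_mul_card_filter_lt (S : Finset ℕ) :
    2 * ((S ×ˢ S).filter fun x => x.1 < x.2).card + S.card = S.card * S.card := by
  have h1 : ((S ×ˢ S).filter fun x => x.1 < x.2).card =
      ((S ×ˢ S).filter fun x => x.2 < x.1).card :=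
    Finset.card_nbij' Prod.swap Prod.swap (by intro x; simp; tauto) (by intro x; simp; tauto)
      (fun _ _ => Prod.swap_swap _)
      (fun _ _ => Prod.swap_swap _)
  have h2 : S.offDiag = ((S ×ˢ S).filter fun x => x.1 < x.2).disjUnion
      ((S ×ˢ S).filter fun x => x.2 < x.1) (by
        rw [Finset.disjoint_left]
        intro x hx hx'
        exact lt_asymm (Finset.mem_filter.1 hx).2 (Finset.mem_filter.1 hx').2) := by
    ext x
    simp only [Finset.mem_offDiag, Finset.mem_disjUnion, Finset.mem_filter, Finset.mem_product,
      ← and_or_left, ne_iff_lt_or_gt]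
    tauto
  have h3 := congrArg Finset.card h2
  rw [Finset.offDiag_card, Finset.card_disjUnion, ← h1] at h3
  have : S.card ≤ S.card * S.card := Nat.le_mul_self _
  omega

/-- The source of the multiplicities in `moveCoeff`. Equal lengths give $\binom m2$ pairs; for
distinct lengths the longer row automatically comes first, so every pair counts. -/
theorem card_pairs (lam : n.Partition) {i₀ j₀ : ℕ} (h : i₀ < j₀) (hj₀ : part lam j₀ ≠ 0) :
    (∑ j ∈ Finset.range n, ∑ i ∈ Finset.range j,
      if part lam i = part lam i₀ ∧ part lam j = part lam j₀ then (1 : F) else 0) =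
    (1 + if part lam i₀ = part lam j₀ then (1 : F) else 0)⁻¹ *
      (lam.parts.count (part lam i₀) : F) *
      ((lam.parts.count (part lam j₀) : F) - if part lam i₀ = part lam j₀ then (1 : F) else 0) := by
  have hi₀ : part lam i₀ ≠ 0 :=
    ((Nat.pos_of_ne_zero hj₀).trans_le (part_antitone lam h.le)).ne'
  set A := (Finset.range n).filter fun i => part lam i = part lam i₀ with hA
  set B := (Finset.range n).filter fun i => part lam i = part lam j₀ with hB
  have h1 : (∑ j ∈ Finset.range n, ∑ i ∈ Finset.range j,
      if part lam i = part lam i₀ ∧ part lam j = part lam j₀ then (1 : F) else 0) =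
      (((A ×ˢ B).filter fun x => x.1 < x.2).card : F) := by
    rw [Finset.sum_sigma', ← Finset.sum_filter, Finset.sum_const, nsmul_eq_mul, mul_one]
    congr 1
    refine Finset.card_nbij' (fun x => (x.2, x.1)) (fun x => ⟨x.2, x.1⟩) ?_ ?_ ?_ ?_
    · rintro ⟨j, i⟩ hx
      simp [hA, hB] at hx ⊢
      omega
    · rintro ⟨i, j⟩ hx
      simp [hA, hB] at hx ⊢
      omega
    · intro _ _
      rfl
    · intro _ _
      rfl
  rw [h1, count_parts lam hi₀, count_parts lam hj₀, ← hA, ← hB]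
  split_ifs with he
  · have hAB : A = B := by rw [hA, hB, he]
    have := congrArg (Nat.cast : ℕ → F) (two_mul_card_filter_lt A)
    rw [← hAB]
    push_cast at this
    have h2 : (1 + 1 : F) ≠ 0 := by norm_num
    field_simp
    linear_combination this
  · have : (A ×ˢ B).filter (fun x => x.1 < x.2) = A ×ˢ B := by
      refine Finset.filter_true_of_mem fun x hx => ?_
      simp only [hA, hB, Finset.mem_product, Finset.mem_filter] at hx
      by_contra! hc
      have h2 := part_antitone lam hc
      have h3 := part_antitone lam h.le
      omega
    rw [this, Finset.card_product]
    simp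

-- This is the form in which $D'q_\lambda$ arises, one term per move. Moves with the same result
-- have the same weight by `isMoveUp_iff`, and `card_pairs` counts them.
open Classical in
theorem r_eq_sum (lam mu : n.Partition) :
    r lam mu = (if mu = lam then e' lam else 0) +
      ∑ j ∈ Finset.range n, ∑ i ∈ Finset.range j, ∑ k ∈ Finset.range (part lam j),
        if IsMoveUp lam i j (k + 1) mu then
          (part lam i : F) - part lam j + 2 * ((k : F) + 1) else 0 := by
  unfold r
  by_cases h : ∃ t : ℕ × ℕ × ℕ, IsMoveUp lam t.1 t.2.1 t.2.2 mu
  · have ht := h.choose_spec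
    rw [if_neg ht.ne, if_neg ht.ne, dif_pos h, zero_add]
    generalize h.choose = t at ht ⊢
    obtain ⟨i₀, j₀, k₀⟩ := t
    simp only at ht ⊢
    have hj₀ : part lam j₀ ≠ 0 := by have := ht.2.1; have := ht.2.2.1; omega
    have key : ∀ j ∈ Finset.range n, ∀ i ∈ Finset.range j,
        (∑ k ∈ Finset.range (part lam j), if IsMoveUp lam i j (k + 1) mu then
          (part lam i : F) - part lam j + 2 * ((k : F) + 1) else 0) =
        (if part lam i = part lam i₀ ∧ part lam j = part lam j₀ then (1 : F) else 0) *
          ((part lam i₀ : F) - part lam j₀ + 2 * (k₀ : F)) := fun j _ i hi => by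
      simp only [isMoveUp_iff ht (Finset.mem_range.1 hi)]
      by_cases hc : part lam i = part lam i₀ ∧ part lam j = part lam j₀
      · have h1 := ht.2.1
        have h2 := ht.2.2.1
        -- The index $k$ stands for a move of $k+1$ squares.
        rw [if_pos hc, one_mul, Finset.sum_eq_single (k₀ - 1)]
        · rw [if_pos ⟨hc.1, hc.2, by omega⟩, hc.1, hc.2, Nat.cast_sub h1]
          push_cast
          ring
        · intro k _ hk
          rw [if_neg]
          omega
        · intro hk
          simp only [Finset.mem_range] at hk
          omega
      · rw [if_neg hc, zero_mul]
        refine Finset.sum_eq_zero fun k _ => if_neg fun hk => hc ⟨hk.1, hk.2.1⟩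
    rw [Finset.sum_congr rfl fun j hj => Finset.sum_congr rfl fun i hi => key j hj i hi]
    simp only [← Finset.sum_mul]
    rw [card_pairs lam ht.1 hj₀]
    rfl
  · have h0 : ∀ i j k, ¬ IsMoveUp lam i j k mu := fun i j k hk => h ⟨(i, j, k), hk⟩
    rw [dif_neg h]
    simp [h0]

theorem opD'_q (lam : n.Partition) : opD' (q lam) = ∑ mu, r lam mu • q mu := by
  classical
  simp only [r_eq_sum, add_smul, Finset.sum_add_distrib, ite_smul, zero_smul, Finset.sum_ite_eq',
    Finset.mem_univ, if_true]
  rw [q_eq_prod, opD'_prod_qRow (part lam) n, ← q_eq_prod]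
  refine congrArg (e' lam • q lam + ·) ?_
  simp only [Finset.sum_smul, ite_smul, zero_smul]
  refine Eq.trans (Finset.sum_congr rfl fun j _ => ?_) Finset.sum_comm
  refine Eq.trans (Finset.sum_congr rfl fun i hi => ?_) Finset.sum_comm
  refine Eq.trans (Finset.sum_congr rfl fun k hk => ?_) Finset.sum_comm
  obtain ⟨nu, hnu⟩ := exists_isMoveUp lam (Finset.mem_range.1 hi) (Nat.succ_pos k)
    (Finset.mem_range.1 hk)
  rw [Finset.sum_eq_single nu]
  · rw [if_pos hnu, hnu.q_eq]
  · intro mu _ hmu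
    rw [if_neg fun h => hmu (h.unique hnu)]
  · simp

theorem domLE_of_r_ne_zero {lam mu : n.Partition} (h : r lam mu ≠ 0) : DomLE lam mu := by
  unfold r at h
  split_ifs at h with h1 h2
  · exact h1 ▸ domLE_refl _
  · exact h2.choose_spec.domLE
  · exact absurd rfl h

theorem r_self (lam : n.Partition) : r lam lam = e' lam := if_pos rfl

end Moves

/-! ### Duality between the `q_μ` and the monomials -/

theorem derivation_prod {ι : Type*} [DecidableEq ι] (D : Derivation F SymF SymF)
    (s : Finset ι) (g : ι → SymF) :
    D (∏ i ∈ s, g i) = ∑ i ∈ s, D (g i) * ∏ l ∈ s.erase i, g l := by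
  induction s using Finset.induction_on with
  | empty => simp
  | insert a s ha ih =>
    rw [Finset.prod_insert ha, Derivation.leibniz, ih, Finset.sum_insert ha,
      Finset.erase_insert ha, smul_eq_mul, smul_eq_mul, Finset.mul_sum, add_comm,
      mul_comm (∏ i ∈ s, g i)]
    congr 1
    refine Finset.sum_congr rfl fun i hi => ?_
    have hia : i ≠ a := fun h => ha (h ▸ hi)
    rw [Finset.erase_insert_of_ne hia.symm, Finset.prod_insert (by simp [ha])]
    ring

theorem constantCoeff_qRow (n : ℕ) :
    MvPolynomial.constantCoeff (qRow n) = if n = 0 then 1 else 0 := by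
  rw [MvPolynomial.constantCoeff_eq, coeff_qRow, expSize_zero, expNorm_zero, inv_one]
  simp only [eq_comm]

/-- The scalar product with `∏ Q_{d_i}` reads off the coefficient of `x ^ d`. -/
theorem scalar_prod_qRow {N : ℕ} (d : Fin N →₀ ℕ) (f : SymF) :
    scalar (∏ i, qRow (d i)) f = (toVars N f).coeff d := by
  induction f using MvPolynomial.induction_on generalizing d with
  | C a =>
    rw [scalar_comm, ← MvPolynomial.monomial_zero', scalar_monomial_left, expNorm_zero,
      ← MvPolynomial.constantCoeff_eq, map_prod, MvPolynomial.monomial_zero',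
      toVars, MvPolynomial.aeval_C, MvPolynomial.algebraMap_eq, MvPolynomial.coeff_C]
    simp only [constantCoeff_qRow, Finset.prod_ite_zero, Finset.prod_const_one, Finset.mem_univ,
      true_implies, mul_one, mul_ite, mul_zero]
    refine if_congr ?_ rfl rfl
    rw [eq_comm, DFunLike.ext_iff]
    rfl
  | add f g hf hg =>
    rw [scalar_add_right, hf, hg, map_add, MvPolynomial.coeff_add]
  | mul_X f k ih =>
    obtain ⟨i, rfl⟩ : ∃ i : ℕ, k = i.succPNat := ⟨k.natPred, by simp⟩
    -- By adjointness $p_k$ acts on $\prod_l Q_{d_l}$ as a derivation lowering one $d_l$ by $k$.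
    -- Multiplication by $\sum_l x_l^k$ has the same effect on coefficients.
    rw [mul_comm, ← p_succ, ← scalar_lower_left, derivation_prod, mul_comm, map_mul, p_succ,
      toVars, MvPolynomial.aeval_X, ← toVars, MvPolynomial.psum, Finset.mul_sum,
      MvPolynomial.coeff_sum, ← scalarBilin_apply, map_sum, LinearMap.sum_apply]
    refine Finset.sum_congr rfl fun l _ => ?_
    rw [MvPolynomial.X_pow_eq_monomial, MvPolynomial.coeff_mul_monomial', lower_qRow,
      mul_one, Nat.succPNat_coe, Nat.succ_eq_add_one]
    simp only [Finsupp.single_le_iff]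
    split_ifs with h
    · rw [← ih, scalarBilin_apply, ← Finset.mul_prod_erase _ _ (Finset.mem_univ l)]
      congr 2
      · simp
      · refine Finset.prod_congr rfl fun m hm => ?_
        have : m ≠ l := (Finset.mem_erase.1 hm).1
        simp [this.symm]
    · simp

theorem prod_map_X {N : ℕ} (t : Multiset (Fin N)) :
    (t.map MvPolynomial.X).prod =
      (MvPolynomial.monomial (Multiset.toFinsupp t) 1 : MvPolynomial (Fin N) F) := by
  induction t using Multiset.induction_on with
  | empty => simp
  | cons a s ih =>
    rw [Multiset.map_cons, Multiset.prod_cons, ih, ← Multiset.singleton_add,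
      map_add, Multiset.toFinsupp_singleton, MvPolynomial.X, MvPolynomial.monomial_mul, one_mul]

theorem ofSym_parts {N n : ℕ} (s : Sym (Fin N) n) :
    (Nat.Partition.ofSym s).parts =
      ((Finset.univ : Finset (Fin N)).val.map fun i => s.1.count i).filter (· ≠ 0) := by
  rw [Multiset.filter_map]
  change s.1.dedup.map s.1.count = _
  congr 1
  have : s.1.toFinset = Finset.univ.filter fun i => s.1.count i ≠ 0 := by
    ext i
    simp
  exact congrArg Finset.val this

/-- The exponent `(ν_1, …, ν_N)`. -/
noncomputable def rowExp (N : ℕ) {m : ℕ} (nu : m.Partition) : Fin N →₀ ℕ :=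
  Finsupp.equivFunOnFinite.symm fun i => part nu i

theorem filter_map_rowExp {m : ℕ} (nu : m.Partition) :
    ((Finset.univ : Finset (Fin m)).val.map (rowExp m nu)).filter (· ≠ 0) = nu.parts := by
  conv_rhs => rw [← filter_map_part nu]
  congr 1
  have : (Finset.univ : Finset (Fin m)).val.map (fun i : Fin m => (i : ℕ)) =
      (Finset.range m).val := by
    have h := congrArg Finset.val (Fin.map_valEmbedding_univ (n := m))
    rw [Nat.Iio_eq_range] at h
    exact h
  rw [← this, Multiset.map_map]
  rfl

/-- The degrees $n$ and $m$ may differ, hence the comparison of parts; $m$ variables suffice for the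
rows of $\nu$. -/
theorem coeff_msymm {n m : ℕ} (mu : n.Partition) (nu : m.Partition) :
    (MvPolynomial.msymm (Fin m) F mu).coeff (rowExp m nu) =
      if nu.parts = mu.parts then 1 else 0 := by
  rw [MvPolynomial.msymm, MvPolynomial.coeff_sum]
  simp only [prod_map_X, MvPolynomial.coeff_monomial]
  have key : ∀ s : Sym (Fin m) n, Multiset.toFinsupp s.1 = rowExp m nu →
      (Nat.Partition.ofSym s).parts = nu.parts := fun s hs => by
    rw [ofSym_parts, ← filter_map_rowExp nu, ← hs]
    rfl
  split_ifs with h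
  · have hc : Multiset.card (Finsupp.toMultiset (rowExp m nu)) = n := by
      rw [Finsupp.card_toMultiset, ← mu.parts_sum, ← h, nu.parts_sum,
        Finsupp.sum_fintype _ _ (by simp)]
      have := sum_part nu le_rfl
      rw [Finset.sum_range] at this
      exact this
    let s₀ : Sym (Fin m) n := ⟨Finsupp.toMultiset (rowExp m nu), hc⟩
    have hs₀ : Multiset.toFinsupp s₀.1 = rowExp m nu := Finsupp.toMultiset_toFinsupp _
    rw [Finset.sum_eq_single ⟨s₀, Nat.Partition.ext ((key s₀ hs₀).trans h)⟩]
    · exact if_pos hs₀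
    · intro s _ hs
      refine if_neg fun hs' => hs (Subtype.ext (Subtype.ext ?_))
      exact Multiset.toFinsupp.injective (hs'.trans hs₀.symm)
    · simp
  · refine Finset.sum_eq_zero fun s _ => if_neg fun hs => h ?_
    rw [← key s.1 hs, s.2]

theorem scalar_q {m : ℕ} (nu : m.Partition) (f : SymF) :
    scalar (q nu) f = (toVars m f).coeff (rowExp m nu) := by
  rw [← scalar_prod_qRow, q_eq_prod, Finset.prod_range]
  rfl

theorem scalar_q_of_toVars_eq {n m : ℕ} {f : SymF} {c : n.Partition → F}
    (h : ∀ N : ℕ, toVars N f = ∑ mu, c mu • MvPolynomial.msymm (Fin N) F mu) (nu : m.Partition) :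
    scalar (q nu) f = ∑ mu : n.Partition, if nu.parts = mu.parts then c mu else 0 := by
  rw [scalar_q, h, MvPolynomial.coeff_sum]
  refine Finset.sum_congr rfl fun mu _ => ?_
  rw [MvPolynomial.coeff_smul, coeff_msymm, smul_eq_mul, mul_ite, mul_one, mul_zero]

/-! ### The span of the `q_μ` -/

theorem expSize_eq_of_coeff_q_ne_zero {n : ℕ} (mu : n.Partition) (d : ℕ+ →₀ ℕ)
    (h : (q mu).coeff d ≠ 0) : expSize d = n := by
  have key : ∀ (t : Multiset ℕ) (d : ℕ+ →₀ ℕ), ((t.map qRow).prod).coeff d ≠ 0 →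
      expSize d = t.sum := fun t => by
    induction t using Multiset.induction_on with
    | empty =>
      intro d hd
      rw [Multiset.map_zero, Multiset.prod_zero, MvPolynomial.coeff_one] at hd
      have : 0 = d := by
        by_contra h0
        exact hd (if_neg h0)
      simp [← this, expSize_zero]
    | cons a t ih =>
      intro d hd
      classical
      rw [Multiset.map_cons, Multiset.prod_cons, MvPolynomial.coeff_mul] at hd
      obtain ⟨x, hx, hx0⟩ := Finset.exists_ne_zero_of_sum_ne_zero hd
      rw [← Finset.HasAntidiagonal.mem_antidiagonal.1 hx, expSize_add, ih _ (right_ne_zero_of_mul hx0),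
        Multiset.sum_cons]
      have h1 := left_ne_zero_of_mul hx0
      rw [coeff_qRow] at h1
      rw [show expSize x.1 = a by
        by_contra h0
        exact h1 (if_neg h0)]
  rw [key _ d h, mu.parts_sum]

theorem scalar_q_q_eq_zero {n m : ℕ} (hnm : m ≠ n) (mu : n.Partition) (nu : m.Partition) :
    scalar (q mu) (q nu) = 0 := by
  rw [scalar_eq_sum _ _ _ subset_rfl]
  refine Finset.sum_eq_zero fun d hd => ?_
  simp only [Finset.mem_inter, MvPolynomial.mem_support_iff] at hd
  exact absurd ((expSize_eq_of_coeff_q_ne_zero nu d hd.2).symm.trans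
    (expSize_eq_of_coeff_q_ne_zero mu d hd.1)) hnm

theorem prod_map_qRow (t : Multiset ℕ) : (t.map qRow).prod = q (Nat.Partition.ofMultiset t) :=
  (prod_map_filter_ne_zero qRow qRow_zero t).symm

/-- Since $Q_0=1$, the Newton recursion can be solved for its last power sum. -/
theorem p_mem_adjoin (n : ℕ) : p (n + 1) ∈ Algebra.adjoin F (Set.range qRow) := by
  induction n using Nat.strong_induction_on with
  | _ n ih =>
    have hq (k : ℕ) : qRow k ∈ Algebra.adjoin F (Set.range qRow) :=
      Algebra.subset_adjoin ⟨k, rfl⟩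
    have h := smul_qRow (n + 1)
    rw [Finset.sum_range_succ, Nat.sub_self, qRow_zero, mul_one, ← sub_eq_iff_eq_add'] at h
    rw [← h]
    refine sub_mem (Subalgebra.smul_mem _ (hq _) _) (sum_mem fun i hi => ?_)
    exact mul_mem (ih i (Finset.mem_range.1 hi)) (hq _)

theorem adjoin_qRow : Algebra.adjoin F (Set.range qRow) = ⊤ := by
  rw [eq_top_iff, ← MvPolynomial.adjoin_range_X, Algebra.adjoin_le_iff]
  rintro _ ⟨k, rfl⟩
  have := p_mem_adjoin k.natPred
  rw [p_succ, PNat.succPNat_natPred] at this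
  exact this

theorem span_q : Submodule.span F (Set.range fun x : Σ m : ℕ, m.Partition => q x.2) = ⊤ := by
  rw [← Algebra.top_toSubmodule, ← adjoin_qRow, Algebra.adjoin_eq_span]
  congr 1
  ext f
  constructor
  · rintro ⟨⟨m, nu⟩, rfl⟩
    refine Submonoid.multiset_prod_mem _ _ fun f hf => ?_
    obtain ⟨k, -, rfl⟩ := Multiset.mem_map.1 hf
    exact Submonoid.subset_closure ⟨k, rfl⟩
  · intro hf
    obtain ⟨l, hl, rfl⟩ := Submonoid.exists_multiset_of_mem_closure hf
    have : ∃ t : Multiset ℕ, t.map qRow = l := by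
      clear hf
      induction l using Multiset.induction_on with
      | empty => exact ⟨0, rfl⟩
      | cons a s ih =>
        obtain ⟨t, rfl⟩ := ih fun y hy => hl y (Multiset.mem_cons_of_mem hy)
        obtain ⟨k, rfl⟩ := hl a (Multiset.mem_cons_self a _)
        exact ⟨k ::ₘ t, Multiset.map_cons _ _ _⟩
    obtain ⟨t, rfl⟩ := this
    exact ⟨⟨_, Nat.Partition.ofMultiset t⟩, (prod_map_qRow t).symm⟩

/-- The part of $f$ in the span of the $q_\nu$ of other degrees is orthogonal to every $q_\nu$,
hence zero by nondegeneracy. -/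
theorem mem_span_q {n : ℕ} {f : SymF}
    (hf : ∀ m ≠ n, ∀ nu : m.Partition, scalar (q nu) f = 0) :
    f ∈ Submodule.span F (Set.range (q (n := n))) := by
  set S := Submodule.span F (Set.range (q (n := n)))
  set T := Submodule.span F (Set.range fun x : {x : Σ m : ℕ, m.Partition // x.1 ≠ n} => q x.1.2)
  have hST : S ⊔ T = ⊤ := by
    rw [eq_top_iff, ← span_q, Submodule.span_le]
    rintro _ ⟨⟨m, nu⟩, rfl⟩
    by_cases hm : m = n
    · subst hm
      exact Submodule.mem_sup_left (Submodule.subset_span ⟨nu, rfl⟩)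
    · exact Submodule.mem_sup_right (Submodule.subset_span ⟨⟨⟨m, nu⟩, hm⟩, rfl⟩)
  obtain ⟨a, ha, b, hb, rfl⟩ := Submodule.mem_sup.1 (hST ▸ Submodule.mem_top : f ∈ S ⊔ T)
  have hSn : ∀ x ∈ S, ∀ m ≠ n, ∀ nu : m.Partition, scalar (q nu) x = 0 := fun x hx m hm nu => by
    have : S ≤ LinearMap.ker (scalarBilin (q nu)) := by
      rw [Submodule.span_le]
      rintro _ ⟨mu, rfl⟩
      exact scalar_q_q_eq_zero (Ne.symm hm) nu mu
    exact this hx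
  have hTn : ∀ mu : n.Partition, scalar (q mu) b = 0 := fun mu => by
    have : T ≤ LinearMap.ker (scalarBilin (q mu)) := by
      rw [Submodule.span_le]
      rintro _ ⟨⟨⟨m, nu⟩, hm⟩, rfl⟩
      exact scalar_q_q_eq_zero hm mu nu
    exact this hb
  have hb0 : b = 0 := by
    refine eq_zero_of_scalar_eq_zero b fun g => ?_
    have : (⊤ : Submodule F SymF) ≤ LinearMap.ker (scalarBilin.flip b) := by
      rw [← span_q, Submodule.span_le]
      rintro _ ⟨⟨m, nu⟩, rfl⟩
      change scalar (q nu) b = 0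
      by_cases hm : m = n
      · subst hm
        exact hTn nu
      · have := hf m hm nu
        rwa [scalar_add_right, hSn a ha m hm nu, zero_add] at this
    exact this (Submodule.mem_top (x := g))
  rw [hb0, add_zero]
  exact ha

section Jack

variable {n : ℕ}

/-! ### Triangularity -/

/-- A counterexample with maximal `rowSum` has no counterexample strictly below it in dominance
order, so its equation reduces to the diagonal term. -/
theorem eq_zero_of_unitriangular {c : n.Partition → n.Partition → F} (h1 : ∀ lam, c lam lam = 1)
    (h0 : ∀ lam mu, ¬ DomLE mu lam → c lam mu = 0) (D : n.Partition → Prop)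
    (hD : ∀ lam mu, D lam → DomLE mu lam → D mu) (X : n.Partition → F)
    (hX : ∀ lam, D lam → ∑ mu, X mu * c lam mu = 0) : ∀ lam, D lam → X lam = 0 := by
  classical
  by_contra! hc
  obtain ⟨lam₀, hlam₀⟩ := hc
  obtain ⟨lam, hlam, hmax⟩ := Finset.exists_max_image
    (Finset.univ.filter fun lam => D lam ∧ X lam ≠ 0) rowSum ⟨lam₀, by simpa using hlam₀⟩
  simp only [Finset.mem_filter, Finset.mem_univ, true_and] at hlam hmax
  have h := hX lam hlam.1
  rw [Finset.sum_eq_single lam, h1, mul_one] at h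
  · exact hlam.2 h
  · intro mu _ hmu
    by_cases hd : DomLE mu lam
    · by_cases hx : X mu = 0
      · rw [hx, zero_mul]
      · exact absurd (hmax mu ⟨hD lam mu hlam.1 hd, hx⟩) (not_le.2 (hd.rowSum_lt hmu))
    · rw [h0 lam mu hd, mul_zero]
  · simp

theorem IsJackFamily.exists_coeff {P : n.Partition → SymF} (hP : IsJackFamily n P) :
    ∃ c : n.Partition → n.Partition → F, (∀ lam, c lam lam = 1) ∧
      (∀ lam mu, ¬ DomLE mu lam → c lam mu = 0) ∧
      (∀ lam mu, scalar (q mu) (P lam) = c lam mu) ∧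
      ∀ lam, P lam ∈ Submodule.span F (Set.range (q (n := n))) := by
  choose c h1 h0 hc using hP.1
  refine ⟨c, h1, h0, fun lam mu => ?_, fun lam => mem_span_q fun m hm nu => ?_⟩
  · rw [scalar_q_of_toVars_eq (hc lam)]
    simp only [← Nat.Partition.ext_iff, Finset.sum_ite_eq, Finset.mem_univ, if_true]
  · rw [scalar_q_of_toVars_eq (hc lam)]
    refine Finset.sum_eq_zero fun mu _ => if_neg fun h => hm ?_
    rw [← nu.parts_sum, h, mu.parts_sum]

theorem scalar_sum_smul_left {ι : Type*} (s : Finset ι) (X : ι → F) (v : ι → SymF) (g : SymF) :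
    scalar (∑ i ∈ s, X i • v i) g = ∑ i ∈ s, X i * scalar (v i) g := by
  rw [← scalarBilin_apply, map_sum, LinearMap.sum_apply]
  simp [scalarBilin_apply]

/-- Taking $D$ to be everything yields linear independence; taking the partitions not above
$\lambda$ yields the support of $Q_\lambda$. -/
theorem IsJackFamily.coeff_eq_zero {P : n.Partition → SymF} (hP : IsJackFamily n P)
    (D : n.Partition → Prop) (hD : ∀ lam mu, D lam → DomLE mu lam → D mu) (X : n.Partition → F)
    (hX : ∀ lam, D lam → scalar (∑ mu, X mu • q mu) (P lam) = 0) : ∀ lam, D lam → X lam = 0 := by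
  obtain ⟨c, h1, h0, hc, -⟩ := hP.exists_coeff
  refine eq_zero_of_unitriangular h1 h0 D hD X fun lam hlam => ?_
  rw [← hX lam hlam, scalar_sum_smul_left]
  simp only [hc]

theorem IsJackFamily.linearIndependent_q {P : n.Partition → SymF} (hP : IsJackFamily n P) :
    LinearIndependent F (q (n := n)) := by
  rw [Fintype.linearIndependent_iff]
  intro X hX mu
  refine hP.coeff_eq_zero (fun _ => True) (fun _ _ _ _ => trivial) X (fun lam _ => ?_) mu trivial
  rw [hX, ← scalarBilin_apply, map_zero, LinearMap.zero_apply]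

theorem IsJackFamily.eq_zero {P : n.Partition → SymF} (hP : IsJackFamily n P) {f : SymF}
    (hf : f ∈ Submodule.span F (Set.range (q (n := n))))
    (h : ∀ lam, scalar f (P lam) = 0) : f = 0 := by
  obtain ⟨X, rfl⟩ := (Submodule.mem_span_range_iff_exists_fun F).1 hf
  have := hP.coeff_eq_zero (fun _ => True) (fun _ _ _ _ => trivial) X (fun lam _ => h lam)
  simp [this]

/-- Otherwise $P_\lambda$ would be orthogonal to all $P_\mu$, hence zero, against its leading
coefficient $1$. -/
theorem IsJackFamily.norm_ne_zero {P : n.Partition → SymF} (hP : IsJackFamily n P)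
    (lam : n.Partition) : scalar (P lam) (P lam) ≠ 0 := fun h => by
  obtain ⟨c, h1, -, hc, hspan⟩ := hP.exists_coeff
  have h0 : P lam = 0 := hP.eq_zero (hspan lam) fun mu => by
    by_cases hmu : lam = mu
    · rwa [← hmu]
    · exact hP.2 lam mu hmu
  have := (hc lam lam).trans (h1 lam)
  rw [h0, ← scalarBilin_apply, map_zero] at this
  exact zero_ne_one this

theorem scalar_jackQ_left (P : n.Partition → SymF) (lam : n.Partition) (g : SymF) :
    scalar (jackQ P lam) g = (scalar (P lam) (P lam))⁻¹ * scalar (P lam) g := by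
  rw [jackQ, scalar_comm, scalar_smul_right, scalar_comm g]

theorem IsJackFamily.scalar_jackQ_self {P : n.Partition → SymF} (hP : IsJackFamily n P)
    (lam : n.Partition) : scalar (jackQ P lam) (P lam) = 1 := by
  rw [scalar_jackQ_left, inv_mul_cancel₀ (hP.norm_ne_zero lam)]

theorem IsJackFamily.scalar_jackQ_of_ne {P : n.Partition → SymF} (hP : IsJackFamily n P)
    {lam mu : n.Partition} (h : lam ≠ mu) : scalar (jackQ P lam) (P mu) = 0 := by
  rw [scalar_jackQ_left, hP.2 lam mu h, mul_zero]

theorem IsJackFamily.jackQ_mem {P : n.Partition → SymF} (hP : IsJackFamily n P)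
    (lam : n.Partition) : jackQ P lam ∈ Submodule.span F (Set.range (q (n := n))) := by
  obtain ⟨-, -, -, -, hspan⟩ := hP.exists_coeff
  exact Submodule.smul_mem _ _ (hspan lam)

/-- `Q_λ` is a unitriangular combination of the `q_μ`. -/
theorem IsJackFamily.exists_jackQ_eq {P : n.Partition → SymF} (hP : IsJackFamily n P)
    (lam : n.Partition) : ∃ X : n.Partition → F, X lam = 1 ∧ (∀ mu, ¬ DomLE lam mu → X mu = 0) ∧
      jackQ P lam = ∑ mu, X mu • q mu := by
  obtain ⟨X, hX⟩ := (Submodule.mem_span_range_iff_exists_fun F).1 (hP.jackQ_mem lam)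
  have hX0 : ∀ mu, ¬ DomLE lam mu → X mu = 0 := by
    refine hP.coeff_eq_zero (fun mu => ¬ DomLE lam mu) (fun _ _ h1 h2 h3 => h1 (h3.trans h2)) X
      fun mu hmu => ?_
    rw [hX]
    exact hP.scalar_jackQ_of_ne fun h => hmu (h ▸ domLE_refl lam)
  refine ⟨X, ?_, hX0, hX.symm⟩
  obtain ⟨c, h1, h0, hc, -⟩ := hP.exists_coeff
  have h := hP.scalar_jackQ_self lam
  rw [← hX, scalar_sum_smul_left, Finset.sum_eq_single lam, hc, h1, mul_one] at h
  · exact h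
  · intro mu _ hmu
    rw [hc]
    by_cases hd : DomLE lam mu
    · rw [h0 lam mu fun h => hmu (h.antisymm hd), mul_zero]
    · rw [hX0 mu hd, zero_mul]
  · simp

/-! ### The eigenvector equation -/

theorem opD'_mem_span {f : SymF} (hf : f ∈ Submodule.span F (Set.range (q (n := n)))) :
    opD' f ∈ Submodule.span F (Set.range (q (n := n))) := by
  have : Submodule.span F (Set.range (q (n := n))) ≤
      (Submodule.span F (Set.range (q (n := n)))).comap opLin := by
    rw [Submodule.span_le]
    rintro _ ⟨mu, rfl⟩
    change opD' (q mu) ∈ Submodule.span F (Set.range (q (n := n)))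
    rw [opD'_q]
    exact Submodule.sum_mem _ fun nu _ =>
      Submodule.smul_mem _ _ (Submodule.subset_span ⟨nu, rfl⟩)
  exact this hf

theorem opD'_sum_smul {ι : Type*} (s : Finset ι) (X : ι → F) (v : ι → SymF) :
    opD' (∑ i ∈ s, X i • v i) = ∑ i ∈ s, X i • opD' (v i) := by
  simp only [← opLin_apply, map_sum, map_smul]

/-- `Q_λ` is an eigenvector of `D'(α)` with eigenvalue `e'_λ`. -/
theorem IsJackFamily.opD'_jackQ {P : n.Partition → SymF} (hP : IsJackFamily n P)
    (lam : n.Partition) : opD' (jackQ P lam) = e' lam • jackQ P lam := by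
  obtain ⟨c, h1, h0, hc, -⟩ := hP.exists_coeff
  have hsum : ∀ (X : n.Partition → F) (nu : n.Partition),
      scalar (opD' (∑ mu, X mu • q mu)) (P nu) =
        ∑ mu, ∑ ka, X mu * (r mu ka * c nu ka) := fun X nu => by
    rw [opD'_sum_smul, scalar_sum_smul_left]
    refine Finset.sum_congr rfl fun mu _ => ?_
    rw [opD'_q, scalar_sum_smul_left, Finset.mul_sum]
    simp only [hc]
  have hne : ∀ (mu ka nu : n.Partition), r mu ka * c nu ka ≠ 0 →
      DomLE mu ka ∧ DomLE ka nu := fun mu ka nu h => by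
    refine ⟨domLE_of_r_ne_zero (left_ne_zero_of_mul h), ?_⟩
    by_contra hd
    exact right_ne_zero_of_mul h (h0 nu ka hd)
  -- A nonzero term requires a chain $\lambda\le\mu\le\kappa\le\nu$; for $\nu=\lambda$ the chain
  -- collapses, which gives `hdiag`.
  have htri : ∀ lam nu, ¬ DomLE lam nu → scalar (opD' (jackQ P lam)) (P nu) = 0 :=
    fun lam nu hd => by
      obtain ⟨X, -, hX0, hX⟩ := hP.exists_jackQ_eq lam
      rw [hX, hsum]
      refine Finset.sum_eq_zero fun mu _ => Finset.sum_eq_zero fun ka _ => ?_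
      by_contra h
      have h2 := hne mu ka nu (right_ne_zero_of_mul h)
      have h3 : DomLE lam mu := by
        by_contra h3
        exact left_ne_zero_of_mul h (hX0 mu h3)
      exact hd (h3.trans (h2.1.trans h2.2))
  have hdiag : scalar (opD' (jackQ P lam)) (P lam) = e' lam := by
    obtain ⟨X, hX1, hX0, hX⟩ := hP.exists_jackQ_eq lam
    have hz : ∀ mu ka, X mu * (r mu ka * c lam ka) ≠ 0 → mu = lam ∧ ka = lam :=
      fun mu ka h => by
        have h2 := hne mu ka lam (right_ne_zero_of_mul h)
        have h3 : DomLE lam mu := by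
          by_contra h3
          exact left_ne_zero_of_mul h (hX0 mu h3)
        exact ⟨(h2.1.trans h2.2).antisymm h3, h2.2.antisymm (h3.trans h2.1)⟩
    rw [hX, hsum, Finset.sum_eq_single lam, Finset.sum_eq_single lam, hX1, r_self, h1, one_mul,
      mul_one]
    · intro ka _ hka
      by_contra h
      exact hka (hz _ _ h).2
    · simp
    · intro mu _ hmu
      refine Finset.sum_eq_zero fun ka _ => ?_
      by_contra h
      exact hmu (hz _ _ h).1
    · simp
  refine sub_eq_zero.1 (hP.eq_zero (sub_mem (opD'_mem_span (hP.jackQ_mem lam))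
    (Submodule.smul_mem _ _ (hP.jackQ_mem lam))) fun nu => ?_)
  rw [← scalarBilin_apply, map_sub, LinearMap.sub_apply, map_smul, LinearMap.smul_apply,
    scalarBilin_apply, scalarBilin_apply, smul_eq_mul]
  by_cases hnu : lam = nu
  · rw [← hnu, hdiag, hP.scalar_jackQ_self, mul_one, sub_self]
  · rw [hP.scalar_jackQ_of_ne hnu, mul_zero, sub_zero]
    by_cases hd : DomLE lam nu
    -- Self-adjointness exchanges $\lambda$ and $\nu$, and $\nu\le\lambda$ fails.
    · have h2 := htri nu lam fun h => hnu (hd.antisymm h)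
      rw [scalar_opD', scalar_jackQ_left] at h2 ⊢
      have h3 := (mul_eq_zero.1 h2).resolve_left (inv_ne_zero (hP.norm_ne_zero nu))
      rw [← scalar_opD', scalar_comm (opD' (P lam)), h3, mul_zero]
    · exact htri lam nu hd

/-! ### The partitions dominating a given one -/

theorem IsLexEnum.injective {lam : n.Partition} {s : ℕ} {mu : Fin (s + 1) → n.Partition}
    (hmu : IsLexEnum lam mu) : Function.Injective mu := fun i j h => by
  by_contra hij
  rcases lt_or_gt_of_ne hij with h1 | h1
  · have := hmu.1 i j h1
    rw [h] at this
    exact this.asymm this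
  · have := hmu.1 j i h1
    rw [h] at this
    exact this.asymm this

theorem IsLexEnum.domLE {lam : n.Partition} {s : ℕ} {mu : Fin (s + 1) → n.Partition}
    (hmu : IsLexEnum lam mu) (i : Fin (s + 1)) : DomLE lam (mu i) := (hmu.2 _).2 ⟨i, rfl⟩

theorem IsLexEnum.zero_eq {lam : n.Partition} {s : ℕ} {mu : Fin (s + 1) → n.Partition}
    (hmu : IsLexEnum lam mu) : mu 0 = lam := by
  by_contra h
  obtain ⟨i, hi⟩ := (hmu.2 lam).1 (domLE_refl lam)
  have hi0 : 0 < i := by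
    rw [Fin.pos_iff_ne_zero]
    rintro rfl
    exact h hi
  have h1 := hmu.1 0 i hi0
  rw [hi] at h1
  exact h1.asymm ((hmu.domLE 0).lexLT (Ne.symm h))

theorem IsLexEnum.le_of_domLE {lam : n.Partition} {s : ℕ} {mu : Fin (s + 1) → n.Partition}
    (hmu : IsLexEnum lam mu) {i j : Fin (s + 1)} (h : DomLE (mu i) (mu j)) : i ≤ j := by
  by_contra! hij
  exact (hmu.1 j i hij).asymm (h.lexLT fun he => hij.ne' (hmu.injective he))

theorem IsLexEnum.sum_eq {lam : n.Partition} {s : ℕ} {mu : Fin (s + 1) → n.Partition}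
    (hmu : IsLexEnum lam mu) {A : Type*} [AddCommMonoid A] (f : n.Partition → A)
    (hf : ∀ nu, ¬ DomLE lam nu → f nu = 0) : ∑ nu, f nu = ∑ i, f (mu i) := by
  refine (Fintype.sum_of_injective mu hmu.injective _ _ (fun nu hnu => hf nu fun h => hnu ?_)
    fun i => rfl).symm
  exact (hmu.2 nu).1 h

/-! ### The matrix of $D'$ and the determinant formula -/

theorem IsLexEnum.opD'_q {lam : n.Partition} {s : ℕ} {mu : Fin (s + 1) → n.Partition}
    (hmu : IsLexEnum lam mu) (j : Fin (s + 1)) :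
    opD' (q (mu j)) = ∑ i, M mu i j • q (mu i) := by
  rw [JackDet.opD'_q, hmu.sum_eq]
  · rfl
  · intro nu hnu
    have : r (mu j) nu = 0 := by
      by_contra h
      exact hnu ((hmu.domLE j).trans (domLE_of_r_ne_zero h))
    rw [this, zero_smul]

/-- Lexicographic order refines dominance order, and $D'$ is triangular for the latter. -/
theorem IsLexEnum.M_eq_zero {lam : n.Partition} {s : ℕ} {mu : Fin (s + 1) → n.Partition}
    (hmu : IsLexEnum lam mu) {i j : Fin (s + 1)} (h : i < j) : M mu i j = 0 := by
  by_contra hM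
  exact absurd (hmu.le_of_domLE (domLE_of_r_ne_zero hM)) (not_le.2 h)

theorem IsJackFamily.existsUnique_jackQ_eq {P : n.Partition → SymF} (hP : IsJackFamily n P)
    {lam : n.Partition} {s : ℕ} {mu : Fin (s + 1) → n.Partition} (hmu : IsLexEnum lam mu) :
    ∃! X : Fin (s + 1) → F, jackQ P lam = ∑ i, X i • q (mu i) := by
  obtain ⟨X, -, hX0, hX⟩ := hP.exists_jackQ_eq lam
  have hli := hP.linearIndependent_q.comp mu hmu.injective
  refine ⟨X ∘ mu, ?_, fun Y hY => funext fun i => ?_⟩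
  · rw [hX, hmu.sum_eq]
    · rfl
    · intro nu hnu
      rw [hX0 nu hnu, zero_smul]
  · rw [hX, hmu.sum_eq _ fun nu hnu => by rw [hX0 nu hnu, zero_smul]] at hY
    have := Fintype.linearIndependent_iff.1 hli (fun i => Y i - X (mu i)) (by
      simp only [sub_smul, Finset.sum_sub_distrib, Function.comp_apply]
      rw [← hY, sub_self]) i
    exact sub_eq_zero.1 this

theorem IsJackFamily.coeff_zero_eq_one {P : n.Partition → SymF} (hP : IsJackFamily n P)
    {lam : n.Partition} {s : ℕ} {mu : Fin (s + 1) → n.Partition} (hmu : IsLexEnum lam mu)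
    {X : Fin (s + 1) → F} (h : jackQ P lam = ∑ i, X i • q (mu i)) : X 0 = 1 := by
  obtain ⟨Y, hY1, hY0, hY⟩ := hP.exists_jackQ_eq lam
  have := (hP.existsUnique_jackQ_eq hmu).unique h (y₂ := Y ∘ mu) (by
    rw [hY, hmu.sum_eq _ fun nu hnu => by rw [hY0 nu hnu, zero_smul]]
    rfl)
  rw [this, Function.comp_apply, hmu.zero_eq, hY1]

theorem IsJackFamily.mulVec_M {P : n.Partition → SymF} (hP : IsJackFamily n P)
    {lam : n.Partition} {s : ℕ} {mu : Fin (s + 1) → n.Partition} (hmu : IsLexEnum lam mu)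
    {X : Fin (s + 1) → F} (h : jackQ P lam = ∑ i, X i • q (mu i)) :
    (M mu).mulVec X = e' lam • X := by
  have hli := hP.linearIndependent_q.comp mu hmu.injective
  have h1 := hP.opD'_jackQ lam
  rw [h, opD'_sum_smul, Finset.smul_sum] at h1
  simp only [hmu.opD'_q, Finset.smul_sum, smul_smul] at h1
  rw [Finset.sum_comm] at h1
  simp only [← Finset.sum_smul] at h1
  funext i
  have := Fintype.linearIndependent_iff.1 hli
    (fun i => (∑ j, X j * M mu i j) - e' lam * X i) (by
      simp only [sub_smul, Finset.sum_sub_distrib, Function.comp_apply]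
      rw [h1, sub_self]) i
  change ∑ j, M mu i j * X j = e' lam * X i
  rw [← sub_eq_zero, ← this]
  simp only [mul_comm]

theorem IsLexEnum.det_submatrix {lam : n.Partition} {s : ℕ} {mu : Fin (s + 1) → n.Partition}
    (hmu : IsLexEnum lam mu) :
    ((Nmat lam mu).submatrix Fin.succ Fin.succ).det =
      MvPolynomial.C (∏ i : Fin s, (e' (mu i.succ) - e' (mu 0))) := by
  have hentry : ∀ i j : Fin s, (Nmat lam mu).submatrix Fin.succ Fin.succ i j =
      MvPolynomial.C (M mu i.succ j.succ - if i = j then e' lam else 0) := fun i j => by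
    simp [Nmat, Matrix.updateRow_apply, Matrix.one_apply]
  rw [Matrix.det_of_isLowerTriangular, map_prod]
  · refine Finset.prod_congr rfl fun i _ => ?_
    rw [hentry, if_pos rfl, hmu.zero_eq]
    exact congrArg (fun x => MvPolynomial.C (x - e' lam)) (r_self _)
  · intro i j hij
    have hij : i < j := hij
    rw [hentry, if_neg hij.ne, sub_zero, hmu.M_eq_zero (Fin.succ_lt_succ_iff.2 hij), map_zero]

theorem IsJackFamily.jackQ_eq_det {P : n.Partition → SymF} (hP : IsJackFamily n P)
    {lam : n.Partition} {s : ℕ} {mu : Fin (s + 1) → n.Partition} (hmu : IsLexEnum lam mu) :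
    jackQ P lam = cConst mu • (Nmat lam mu).det := by
  obtain ⟨X, hX, -⟩ := hP.existsUnique_jackQ_eq hmu
  have h0 := hP.coeff_zero_eq_one hmu hX
  have hM := hP.mulVec_M hmu hX
  -- The first row of $N_\lambda$ is the expansion of $Q_\lambda$; the other rows are the
  -- eigenvector equation.
  have hN : (Nmat lam mu).mulVec (fun i => MvPolynomial.C (X i)) = Pi.single 0 (jackQ P lam) := by
    funext i
    refine Fin.cases ?_ (fun i => ?_) i
    · rw [Pi.single_eq_same, hX]
      change ∑ j, Nmat lam mu 0 j * MvPolynomial.C (X j) = _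
      refine Finset.sum_congr rfl fun j _ => ?_
      rw [Nmat, Matrix.updateRow_self, MvPolynomial.smul_eq_C_mul, mul_comm]
    · rw [Pi.single_eq_of_ne (Fin.succ_ne_zero i)]
      have h1 := congrFun hM i.succ
      have h2 : ∑ j, (M mu - e' lam • (1 : Matrix (Fin (s + 1)) (Fin (s + 1)) F)) i.succ j * X j
          = 0 := by
        have : ((M mu - e' lam • (1 : Matrix (Fin (s + 1)) (Fin (s + 1)) F)).mulVec X) i.succ
            = 0 := by
          rw [Matrix.sub_mulVec, Matrix.smul_mulVec, Matrix.one_mulVec, hM, sub_self]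
          rfl
        exact this
      have h3 := congrArg (MvPolynomial.C (σ := ℕ+)) h2
      rw [map_sum, map_zero] at h3
      rw [← h3]
      change ∑ j, Nmat lam mu i.succ j * MvPolynomial.C (X j) = _
      refine Finset.sum_congr rfl fun j _ => ?_
      rw [Nmat, Matrix.updateRow_ne (Fin.succ_ne_zero i), Matrix.map_apply, ← map_mul]
  -- The first entry of $\operatorname{adj}(N)NX=\det(N)X$, with $X_0=1$.
  have h1 : (Nmat lam mu).det =
      (Nmat lam mu).adjugate 0 0 * jackQ P lam := by
    have := congrFun (congrArg ((Nmat lam mu).adjugate.mulVec) hN) 0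
    rw [Matrix.mulVec_mulVec, Matrix.adjugate_mul, Matrix.smul_mulVec, Matrix.one_mulVec,
      Pi.smul_apply, h0, map_one, smul_eq_mul, mul_one, Matrix.mulVec_single] at this
    simpa [mul_comm] using this
  rw [h1, Matrix.adjugate_fin_succ_eq_det_submatrix]
  have h2 := hmu.det_submatrix
  have h3 : (∏ i : Fin s, (e' (mu i.succ) - e' (mu 0))) ≠ 0 := by
    refine Finset.prod_ne_zero_iff.2 fun i _ => sub_ne_zero.2 ?_
    rw [hmu.zero_eq]
    refine (hmu.domLE i.succ).e'_ne fun h => ?_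
    rw [← hmu.zero_eq] at h
    exact Fin.succ_ne_zero i (hmu.injective h).symm
  have h4 : cConst mu = (∏ i : Fin s, (e' (mu i.succ) - e' (mu 0)))⁻¹ := Finset.prod_inv_distrib ..
  rw [Fin.val_zero, add_zero, pow_zero, one_mul]
  change _ = _ • (((Nmat lam mu).submatrix Fin.succ Fin.succ).det * _)
  rw [h2, h4, ← MvPolynomial.smul_eq_C_mul, smul_smul, inv_mul_cancel₀ h3, one_smul]

end Jack

end JackDet

theorem theorem5p4 (n : ℕ) (P : n.Partition → JackDet.SymF) (hP : JackDet.IsJackFamily n P)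
    (lam : n.Partition) (s : ℕ) (mu : Fin (s + 1) → n.Partition)
    (hmu : JackDet.IsLexEnum lam mu) :
    mu 0 = lam ∧
    (∀ j, JackDet.opD' (JackDet.q (mu j)) = ∑ i, JackDet.M mu i j • JackDet.q (mu i)) ∧
    (∃! X : Fin (s + 1) → JackDet.F, JackDet.jackQ P lam = ∑ i, X i • JackDet.q (mu i)) ∧
    (∀ X : Fin (s + 1) → JackDet.F, JackDet.jackQ P lam = ∑ i, X i • JackDet.q (mu i) →
      (JackDet.M mu).mulVec X = JackDet.e' lam • X) ∧
    JackDet.jackQ P lam = JackDet.cConst mu • (JackDet.Nmat lam mu).det :=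
  ⟨hmu.zero_eq, hmu.opD'_q, hP.existsUnique_jackQ_eq hmu, fun _ hX => hP.mulVec_M hmu hX,
    hP.jackQ_eq_det hmu⟩
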